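/- Consider the planar Newtonian three-body problem with equal masses $m>0$ (gravitational constant $1$), $$\ddot q_i=\sum_{j\neq i}\frac{m\,(q_j-q_i)}{|q_j-q_i|^3},\qquad q_i(t)\in\mathbb{R}^2,\quad i=1,2,3,$$ and let $q=(q_1,q_2,q_3)$ be a collision-free solution on an open time interval $I$. Call $q$ a relative equilibrium if all three mutual distances $r_{ij}(t)=|q_i(t)-q_j(t)|$ are constant on $I$, and partially rigid if at least one, but not all, of the three mutual distances is constant on $I$. Then $q$ is not partially rigid. In other words, if at least one of the three mutual distances is constant on $I$, then all three are constant and $q$ is one of Lagrange's relative equilibrium solutions: there are $a,b\in\mathbb{R}^2$, $\omega\in\mathbb{R}$ and a configuration $p_1,p_2,p_3\in\mathbb{R}^2$ with $p_1+p_2+p_3=0$ such that $$q_i(t)=a+tb+R(\omega t)\,p_i\qquad (t\in I,\ i=1,2,3),$$ where $R(\theta)$ is the rotation by the angle $\theta$, and the points $p_1,p_2,p_3$ either form a nondegenerate equilateral triangle or are such that one of them is the midpoint of the other two, which are distinct. -/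

import Mathlib

/-- `q` is a (collision-free, classical) solution on the time set `I` of the Newtonian `n`-body
problem in `E` with masses `m` and gravitational constant `1`:
`q_i'' = ∑_{j ≠ i} m_j (q_j - q_i) / |q_j - q_i|³`. It is used for open intervals `I`. -/
structure IsNBodySolution {ι E : Type*} [Fintype ι] [DecidableEq ι] [NormedAddCommGroup E]
    [InnerProductSpace ℝ E] (m : ι → ℝ) (I : Set ℝ) (q : ι → ℝ → E) : Prop where
  no_collision : ∀ t ∈ I, ∀ i j, i ≠ j → q i t ≠ q j t
  newton : ∃ v : ι → ℝ → E, ∀ t ∈ I, ∀ i,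
    HasDerivAt (q i) (v i t) t ∧
    HasDerivAt (v i)
      (∑ j ∈ Finset.univ.erase i, (m j / ‖q j t - q i t‖ ^ 3) • (q j t - q i t)) t

/-- The mutual distance of the bodies `i` and `j` is constant on `I`. -/
def HasConstantDistance {ι E : Type*} [NormedAddCommGroup E]
    (I : Set ℝ) (q : ι → ℝ → E) (i j : ι) : Prop :=
  ∃ c : ℝ, ∀ t ∈ I, dist (q i t) (q j t) = c

/-- All mutual distances are constant on `I`. -/
def IsRelativeEquilibrium {ι E : Type*} [NormedAddCommGroup E]
    (I : Set ℝ) (q : ι → ℝ → E) : Prop :=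
  ∀ i j, i ≠ j → HasConstantDistance I q i j

/-- At least one, but not all, of the mutual distances is constant on `I`. -/
def IsPartiallyRigid {ι E : Type*} [NormedAddCommGroup E]
    (I : Set ℝ) (q : ι → ℝ → E) : Prop :=
  (∃ i j, i ≠ j ∧ HasConstantDistance I q i j) ∧ ¬ IsRelativeEquilibrium I q

/-- Rotation of the Euclidean plane by the angle `θ`. -/
noncomputable def planeRotation (θ : ℝ) (p : EuclideanSpace ℝ (Fin 2)) :
    EuclideanSpace ℝ (Fin 2) :=
  !₂[Real.cos θ * p 0 - Real.sin θ * p 1, Real.sin θ * p 0 + Real.cos θ * p 1]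

/-- The three points are the vertices of a (nondegenerate) equilateral triangle. -/
def IsEquilateral (p : Fin 3 → EuclideanSpace ℝ (Fin 2)) : Prop :=
  ∃ s : ℝ, 0 < s ∧ ∀ i j, i ≠ j → dist (p i) (p j) = s

/-- One of the three points is the midpoint of the two others, which are distinct: the collinear
shape of a relative equilibrium of three equal masses. -/
def IsSymmetricCollinear (p : Fin 3 → EuclideanSpace ℝ (Fin 2)) : Prop :=
  ∃ i j k : Fin 3, i ≠ j ∧ i ≠ k ∧ p j ≠ p k ∧ p i = midpoint ℝ (p j) (p k)

/-- The motion `q` of three equal masses in the plane has on `I` the form of Lagrange's relative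
equilibria: seen from the uniformly moving centre of mass `a + t b`, a configuration `p`, either an
equilateral triangle or collinear with one body midway between the others, rotates uniformly. -/
def IsLagrangeMotion (I : Set ℝ) (q : Fin 3 → ℝ → EuclideanSpace ℝ (Fin 2)) : Prop :=
  ∃ (a b : EuclideanSpace ℝ (Fin 2)) (ω : ℝ) (p : Fin 3 → EuclideanSpace ℝ (Fin 2)),
    ∑ i, p i = 0 ∧ (IsEquilateral p ∨ IsSymmetricCollinear p) ∧
    ∀ t ∈ I, ∀ i, q i t = a + t • b + planeRotation (ω * t) (p i)

/-!
In the frame in which the bodies of the rigid pair rest at `1` and `-1`, the rigidity of the pair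
is an algebraic constraint on the position `z` and the angular velocity `w`. Together with its time
derivative, the angular momentum and the energy, it relates `z`, `z̄`, the velocities and the
distances of the third body algebraically, with constant coefficients. If `z` took infinitely many
values, then some place of a field of germs (an ultrapower of `ℂ`), finite on the constants, would
send `z` to infinity. At such a place the attraction towards the third body vanishes, except where
`z̄ = ∓1`, and the leading coefficients of the relations, read in dual numbers so as to include
one more time derivative, leave no value for `w` or force the gravitational parameter to vanish.
Hence `z` takes finitely many values, so it is constant by connectedness, and the condition for the
third body to rest admits only Euler's and Lagrange's configurations, in uniform rotation.
-/

section Specialization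

section CommRing

variable {B C : Type*} [CommRing B] [CommRing C]

/-- `x` specializes to `y` along `S`, a subring of `B × C` that is thought of as the graph of a
homomorphism to `C` defined on a subring of `B`. -/
def SpecializesTo (S : Subring (B × C)) (x : B) (y : C) : Prop :=
  (x, y) ∈ S

/-- The subring `S` of `B × C` is the graph of a local homomorphism to `C` from a subring of `B`. -/
class IsLocalGraph (S : Subring (B × C)) : Prop where
  eq_zero : ∀ y, SpecializesTo S 0 y → y = 0
  exists_mul_eq_one : ∀ x y, SpecializesTo S x y → IsUnit y →
    ∃ x' y', SpecializesTo S x' y' ∧ x * x' = 1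

variable {S : Subring (B × C)} {x x' : B} {y y' : C}

namespace SpecializesTo

theorem add (h : SpecializesTo S x y) (h' : SpecializesTo S x' y') :
    SpecializesTo S (x + x') (y + y') :=
  add_mem h h'

theorem sub (h : SpecializesTo S x y) (h' : SpecializesTo S x' y') :
    SpecializesTo S (x - x') (y - y') :=
  sub_mem h h'

theorem mul (h : SpecializesTo S x y) (h' : SpecializesTo S x' y') :
    SpecializesTo S (x * x') (y * y') :=
  mul_mem h h'

theorem neg (h : SpecializesTo S x y) : SpecializesTo S (-x) (-y) :=
  neg_mem h

theorem pow (h : SpecializesTo S x y) (n : ℕ) : SpecializesTo S (x ^ n) (y ^ n) :=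
  pow_mem h n

theorem zero : SpecializesTo S 0 0 :=
  zero_mem S

theorem one : SpecializesTo S 1 1 :=
  one_mem S

theorem ofNat (n : ℕ) [n.AtLeastTwo] : SpecializesTo S (OfNat.ofNat n) (OfNat.ofNat n) :=
  ofNat_mem S n

theorem congr (h : SpecializesTo S x y) (hx : x = x') (hy : y = y') : SpecializesTo S x' y' :=
  hx ▸ hy ▸ h

theorem unique [IsLocalGraph S] (h : SpecializesTo S x y) (h' : SpecializesTo S x y') :
    y = y' :=
  sub_eq_zero.1 (IsLocalGraph.eq_zero _ ((h.sub h').congr (sub_self x) rfl))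

theorem ne_zero [IsLocalGraph S] (h : SpecializesTo S x y) (hy : y ≠ 0) : x ≠ 0 := by
  rintro rfl
  exact hy (h.unique zero)

theorem of_mul [IsLocalGraph S] {b : B} {β : C} (h : SpecializesTo S (x * b) (y * β))
    (hb : SpecializesTo S b β) (hβ : IsUnit β) : SpecializesTo S x y := by
  obtain ⟨b', β', hb', hbb'⟩ := IsLocalGraph.exists_mul_eq_one b β hb hβ
  have hββ' : β * β' = 1 := (hb.mul hb').unique (one.congr hbb'.symm rfl)
  exact (h.mul hb').congr (by rw [mul_assoc, hbb', mul_one]) (by rw [mul_assoc, hββ', mul_one])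

theorem add_one_mul_inv {ι : B} (hι : SpecializesTo S ι 0) (hx : x * ι = 1) :
    SpecializesTo S ((x + 1) * ι) 1 :=
  (one.add hι).congr (by linear_combination -hx) (add_zero 1)

theorem sub_one_mul_inv {ι : B} (hι : SpecializesTo S ι 0) (hx : x * ι = 1) :
    SpecializesTo S ((x - 1) * ι) 1 :=
  (one.sub hι).congr (by linear_combination -hx) (sub_zero 1)

end SpecializesTo

/-- Componentwise specialization of dual numbers. -/
def dualGraph (S : Subring (B × C)) : Subring (DualNumber B × DualNumber C) where
  carrier := {x | SpecializesTo S x.1.fst x.2.fst ∧ SpecializesTo S x.1.snd x.2.snd}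
  add_mem' h h' := ⟨h.1.add h'.1, h.2.add h'.2⟩
  mul_mem' h h' := ⟨by simpa using h.1.mul h'.1,
    by simpa [mul_comm] using (h.1.mul h'.2).add (h.2.mul h'.1)⟩
  neg_mem' h := ⟨h.1.neg, h.2.neg⟩
  zero_mem' := ⟨.zero, .zero⟩
  one_mem' := ⟨.one, .zero⟩

instance [IsLocalGraph S] : IsLocalGraph (dualGraph S) where
  eq_zero _ h := TrivSqZeroExt.ext (h.1.unique .zero) (h.2.unique .zero)
  exists_mul_eq_one x y h hy := by
    obtain ⟨x', y', h', hx⟩ := IsLocalGraph.exists_mul_eq_one _ _ h.1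
      (TrivSqZeroExt.isUnit_iff_isUnit_fst.1 hy)
    have hinv : SpecializesTo (dualGraph S)
        (TrivSqZeroExt.inl x' - TrivSqZeroExt.inr (x' * x' * x.snd))
        (TrivSqZeroExt.inl y' - TrivSqZeroExt.inr (y' * y' * y.snd)) :=
      ⟨by simpa using h', by simpa using ((h'.mul h').mul h.2).neg⟩
    refine ⟨_, _, hinv, TrivSqZeroExt.ext (by simpa using hx) ?_⟩
    simp only [TrivSqZeroExt.snd_mul, TrivSqZeroExt.fst_sub, TrivSqZeroExt.snd_sub,
      TrivSqZeroExt.fst_inl, TrivSqZeroExt.snd_inl, TrivSqZeroExt.fst_inr, TrivSqZeroExt.snd_inr,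
      TrivSqZeroExt.snd_one, smul_eq_mul, MulOpposite.smul_eq_mul_unop, MulOpposite.unop_op]
    linear_combination -x' * x.snd * hx

theorem SpecializesTo.inl (h : SpecializesTo S x y) :
    SpecializesTo (dualGraph S) (TrivSqZeroExt.inl x) (TrivSqZeroExt.inl y) :=
  ⟨h, .zero⟩

theorem SpecializesTo.dual_of_sq [IsLocalGraph S] {X : DualNumber B} {Y : DualNumber C}
    (h : SpecializesTo (dualGraph S) (X ^ 2) Y) (hy : SpecializesTo S X.fst y)
    (hu : IsUnit (2 * y)) :
    ∃ Y', SpecializesTo (dualGraph S) X Y' ∧ Y' ^ 2 = Y ∧ Y'.fst = y := by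
  obtain ⟨c, hc⟩ := hu.exists_left_inv
  have hsnd : SpecializesTo S X.snd (Y.snd * c) := by
    refine SpecializesTo.of_mul (b := 2 * X.fst) (β := 2 * y) (h.2.congr ?_ ?_)
      ((SpecializesTo.ofNat 2).mul hy) hu
    · rw [pow_two, TrivSqZeroExt.snd_mul]
      simp
      ring
    · rw [mul_assoc, hc, mul_one]
  have hX : SpecializesTo (dualGraph S) X
      (TrivSqZeroExt.inl y + TrivSqZeroExt.inr (Y.snd * c)) :=
    ⟨hy.congr rfl (by simp), hsnd.congr rfl (by simp)⟩
  exact ⟨_, hX, (hX.pow 2).unique h, by simp⟩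

end CommRing

section Field

variable {K : Type*} [Field K]

/-- The graph of the place of the field `K` given by the valuation ring `V`. -/
noncomputable def placeGraph (V : ValuationSubring K) : Subring (K × IsLocalRing.ResidueField V) :=
  (V.subtype.prod (IsLocalRing.residue V)).range

/-- The element `x` of the field is finite at the place of `V` and has the value `y` there. -/
abbrev SpecializesAt (V : ValuationSubring K) (x : K) (y : IsLocalRing.ResidueField V) : Prop :=
  SpecializesTo (placeGraph V) x y

/-- The dual number `x` is finite at the place of `V` and has the value `y` there. -/
abbrev DualSpecializesAt (V : ValuationSubring K) (x : DualNumber K)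
    (y : DualNumber (IsLocalRing.ResidueField V)) : Prop :=
  SpecializesTo (dualGraph (placeGraph V)) x y

variable {V : ValuationSubring K} {x : K} {y : IsLocalRing.ResidueField V}

theorem specializesAt_residue (a : V) : SpecializesAt V (a : K) (IsLocalRing.residue V a) :=
  ⟨a, rfl⟩

instance : IsLocalGraph (placeGraph V) where
  eq_zero := by
    rintro y ⟨a, h⟩
    have ha : a = 0 := Subtype.ext (congrArg Prod.fst h)
    have hy : IsLocalRing.residue V a = y := congrArg Prod.snd h
    rw [← hy, ha, map_zero]
  exists_mul_eq_one := by
    rintro x y ⟨a, h⟩ hy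
    have hx : (a : K) = x := congrArg Prod.fst h
    have hay : IsLocalRing.residue V a = y := congrArg Prod.snd h
    obtain ⟨b, hb⟩ := (isUnit_of_map_unit (IsLocalRing.residue V) a (hay ▸ hy)).exists_right_inv
    exact ⟨b, _, specializesAt_residue b, hx ▸ congrArg Subtype.val hb⟩

namespace SpecializesTo

theorem mem (h : SpecializesAt V x y) : x ∈ V := by
  obtain ⟨a, h⟩ := h
  have ha : (a : K) = x := congrArg Prod.fst h
  exact ha ▸ a.2

theorem exists_of_mem (h : x ∈ V) : ∃ y, SpecializesAt V x y :=
  ⟨_, specializesAt_residue ⟨x, h⟩⟩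

theorem inv_of_notMem (h : x ∉ V) : SpecializesAt V x⁻¹ 0 := by
  have hx : x⁻¹ ∈ V := (V.mem_or_inv_mem x).resolve_left h
  refine (specializesAt_residue ⟨x⁻¹, hx⟩).congr rfl
    ((IsLocalRing.residue_eq_zero_iff _).2 fun hu => h ?_)
  obtain ⟨u, hu⟩ := hu.exists_right_inv
  exact inv_inv x ▸ eq_inv_of_mul_eq_one_right (congrArg Subtype.val hu) ▸ u.2

theorem inv (h : SpecializesAt V x y) (hy : y ≠ 0) : SpecializesAt V x⁻¹ y⁻¹ :=
  .of_mul (one.congr (inv_mul_cancel₀ (h.ne_zero hy)).symm (inv_mul_cancel₀ hy).symm) h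
    (isUnit_iff_ne_zero.2 hy)

theorem notMem_of_inv (h : SpecializesAt V x⁻¹ 0) (hx : x ≠ 0) : x ∉ V := fun hm => by
  obtain ⟨y, hy⟩ := exists_of_mem hm
  exact one_ne_zero (one.unique ((h.mul hy).congr (inv_mul_cancel₀ hx) (zero_mul y)))

theorem exists_of_pow {n : ℕ} (hn : n ≠ 0) (h : SpecializesAt V (x ^ n) y) :
    ∃ y', SpecializesAt V x y' ∧ y' ^ n = y := by
  have hx : x ∈ V := by
    by_contra hx
    have hx0 : x ≠ 0 := by rintro rfl; exact hx V.zero_mem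
    exact notMem_of_inv (((inv_of_notMem hx).pow n).congr (inv_pow x n) (zero_pow hn))
      (pow_ne_zero n hx0) h.mem
  obtain ⟨y', hy'⟩ := exists_of_mem hx
  exact ⟨y', hy', (hy'.pow n).unique h⟩

theorem zero_of_pow {n : ℕ} (hn : n ≠ 0) (h : SpecializesAt V (x ^ n) 0) : SpecializesAt V x 0 := by
  obtain ⟨y', h', hy'⟩ := exists_of_pow hn h
  exact h'.congr rfl (eq_zero_of_pow_eq_zero hy')

end SpecializesTo

end Field

end Specialization

section Jets

open TrivSqZeroExt

section RigidityDefect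

variable {A : Type*} [CommRing A]

/-- The polynomial, in terms of positions, velocities and the ratio `ρ` of the distances of the
third body from the rigid pair, whose vanishing is the time derivative of the condition that the
pair be rigid. It is cleared of the powers of the distances. -/
def rigidityDefect (j w z zb p pb ρ : A) : A :=
  6 * j * w * (1 - ρ ^ 3) * (z - zb) * ((z + 1) * (zb + 1))
    + 3 * (p * (zb + 1) + pb * (z + 1) - j * w * (z - zb)) * ((z + 1) + (zb + 1))
    - 3 * ρ ^ 5 * (p * (zb - 1) + pb * (z - 1) + j * w * (z - zb)) * ((z - 1) + (zb - 1))
    - 2 * (1 - ρ ^ 3) * ((z + 1) * (zb + 1)) * (p + pb)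

theorem map_rigidityDefect {B F : Type*} [CommRing B] [FunLike F A B] [RingHomClass F A B] (φ : F)
    (j w z zb p pb ρ : A) :
    φ (rigidityDefect j w z zb p pb ρ) =
      rigidityDefect (φ j) (φ w) (φ z) (φ zb) (φ p) (φ pb) (φ ρ) := by
  simp only [rigidityDefect, map_mul, map_add, map_sub, map_pow, map_one, map_ofNat]

theorem rigidityDefect_swap {j w z zb p pb ρ σ : A}
    (hρ : ρ ^ 2 * ((z - 1) * (zb - 1)) = (z + 1) * (zb + 1)) (hσ : ρ * σ = 1)
    (h : rigidityDefect j w z zb p pb ρ = 0) :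
    rigidityDefect j w (-z) (-zb) (-p) (-pb) σ = 0 := by
  have h5 : σ ^ 5 * ρ ^ 5 = 1 := by rw [← mul_pow, mul_comm, hσ, one_pow]
  have h3 : σ ^ 5 * (1 - ρ ^ 3) * ρ ^ 2 = σ ^ 3 - 1 := by
    linear_combination σ ^ 3 * (σ * ρ + 1) * hσ - h5
  rw [rigidityDefect, ← hρ] at h
  rw [rigidityDefect]
  linear_combination σ ^ 5 * h
    - (6 * j * w * (z - zb) * ((z - 1) * (zb - 1)) - 2 * ((z - 1) * (zb - 1)) * (p + pb)) * h3
    + 3 * (p * (zb - 1) + pb * (z - 1) + j * w * (z - zb)) * ((z - 1) + (zb - 1)) * h5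

variable {C : Type*} [CommRing C] {S : Subring (A × C)} {j w z zb p pb ρ ι t : A}
  {j₀ W M Y R₃ R₅ : C}

theorem exists_ratio_sq_specializesTo [IsLocalGraph S] (hz : z * ι = 1)
    (hι : SpecializesTo S ι 0) (hzb : SpecializesTo S zb Y)
    (hρ : ρ ^ 2 * ((z - 1) * (zb - 1)) = (z + 1) * (zb + 1)) (hY : IsUnit (Y - 1)) :
    ∃ R, SpecializesTo S (ρ ^ 2) R ∧ R * (Y - 1) = Y + 1 := by
  obtain ⟨c, hc⟩ := hY.exists_left_inv
  have hR : (Y + 1) * c * (Y - 1) = Y + 1 := by rw [mul_assoc, hc, mul_one]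
  refine ⟨(Y + 1) * c, .of_mul (b := (z - 1) * ι * (zb - 1)) (β := Y - 1) ?_ ?_ hY, hR⟩
  · exact ((hι.add_one_mul_inv hz).mul (hzb.add .one)).congr
      (by linear_combination -ι * hρ) (by rw [hR, one_mul])
  · exact ((hι.sub_one_mul_inv hz).mul (hzb.sub .one)).congr rfl (one_mul _)

theorem rigidityDefect_leading [IsLocalGraph S] (h : rigidityDefect j w z zb p pb ρ = 0)
    (hz : z * ι = 1) (hι : SpecializesTo S ι 0) (hj : SpecializesTo S j j₀)
    (hzb : SpecializesTo S zb Y) (hw : SpecializesTo S (w * t) W)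
    (hp : SpecializesTo S (p * ι * t) M) (hpb : SpecializesTo S (pb * t) 0)
    (hρ3 : SpecializesTo S (ρ ^ 3) R₃) (hρ5 : SpecializesTo S (ρ ^ 5) R₅) :
    6 * j₀ * W * (1 - R₃) * (Y + 1) = -3 * (M * (Y + 1) - j₀ * W)
      + 3 * R₅ * (M * (Y - 1) + j₀ * W) + 2 * (1 - R₃) * (Y + 1) * M := by
  have hα := hι.add_one_mul_inv hz
  have hβ := hι.sub_one_mul_inv hz
  have ha := hzb.add .one
  have hb := hzb.sub .one
  have hd : SpecializesTo S ((z - zb) * ι) 1 :=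
    (SpecializesTo.one.sub (hzb.mul hι)).congr (by linear_combination -hz) (by simp)
  have key : SpecializesTo S
      (6 * j * (w * t) * (1 - ρ ^ 3) * ((z - zb) * ι) * ((z + 1) * ι * (zb + 1))
        + 3 * (p * ι * t * (zb + 1) + pb * t * ((z + 1) * ι) - j * (w * t) * ((z - zb) * ι))
          * ((z + 1) * ι + (zb + 1) * ι)
        - 3 * ρ ^ 5 * (p * ι * t * (zb - 1) + pb * t * ((z - 1) * ι)
          + j * (w * t) * ((z - zb) * ι)) * ((z - 1) * ι + (zb - 1) * ι)
        - 2 * (1 - ρ ^ 3) * ((z + 1) * ι * (zb + 1)) * (p * ι * t + pb * t * ι))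
      (6 * j₀ * W * (1 - R₃) * 1 * (1 * (Y + 1))
        + 3 * (M * (Y + 1) + 0 * 1 - j₀ * W * 1) * (1 + (Y + 1) * 0)
        - 3 * R₅ * (M * (Y - 1) + 0 * 1 + j₀ * W * 1) * (1 + (Y - 1) * 0)
        - 2 * (1 - R₃) * (1 * (Y + 1)) * (M + 0 * 0)) := by
    refine .sub (.sub (.add ?_ ?_) ?_) ?_ <;>
      apply_rules [SpecializesTo.add, SpecializesTo.sub, SpecializesTo.mul, SpecializesTo.one,
        SpecializesTo.ofNat]
  have h0 := key.unique (SpecializesTo.zero.congr ?_ rfl)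
  · linear_combination h0
  · rw [rigidityDefect] at h
    linear_combination -ι ^ 2 * t * h

/-- The position `z` and its conjugate `zb`, with the inverses `ι` and `ιb`, are both infinite, and
the third body recedes in the direction given by the value `X` of `z / zb`. -/
structure RecedesAlong (S : Subring (A × C)) (z zb ι ιb : A) (X : C) : Prop where
  mul_inv : z * ι = 1
  conj_mul_inv : zb * ιb = 1
  inv : SpecializesTo S ι 0
  conj_inv : SpecializesTo S ιb 0
  quotient : SpecializesTo S (z * ιb) X

namespace RecedesAlong

variable {ιb : A} {X : C}

theorem sub (h : RecedesAlong S z zb ι ιb X) : SpecializesTo S ((z - zb) * ιb) (X - 1) :=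
  (h.quotient.sub .one).congr (by linear_combination h.conj_mul_inv) rfl

theorem add (h : RecedesAlong S z zb ι ιb X) : SpecializesTo S ((z + zb) * ιb) (X + 1) :=
  (h.quotient.add .one).congr (by linear_combination -h.conj_mul_inv) rfl

theorem add_one_mul (h : RecedesAlong S z zb ι ιb X) :
    SpecializesTo S ((z + 1) * ι * ((zb + 1) * ιb)) 1 :=
  ((h.inv.add_one_mul_inv h.mul_inv).mul (h.conj_inv.add_one_mul_inv h.conj_mul_inv)).congr rfl
    (one_mul 1)

theorem sub_one_mul (h : RecedesAlong S z zb ι ιb X) :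
    SpecializesTo S ((z - 1) * ι * ((zb - 1) * ιb)) 1 :=
  ((h.inv.sub_one_mul_inv h.mul_inv).mul (h.conj_inv.sub_one_mul_inv h.conj_mul_inv)).congr rfl
    (one_mul 1)

theorem add_velocity (h : RecedesAlong S z zb ι ιb X) (hp : SpecializesTo S (p * ι) 0)
    (hpb : SpecializesTo S (pb * ιb) 0) : SpecializesTo S ((p + pb) * ιb) 0 :=
  ((hp.mul h.quotient).add hpb).congr (by linear_combination p * ιb * h.mul_inv) (by simp)

variable [IsLocalGraph S]

theorem ratio_sq (h : RecedesAlong S z zb ι ιb X)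
    (hρ : ρ ^ 2 * ((z - 1) * (zb - 1)) = (z + 1) * (zb + 1)) : SpecializesTo S (ρ ^ 2) 1 :=
  .of_mul (h.add_one_mul.congr (by linear_combination -ι * ιb * hρ) (one_mul 1).symm)
    h.sub_one_mul isUnit_one

theorem mul_one_sub_ratio_sq (h : RecedesAlong S z zb ι ιb X)
    (hρ : ρ ^ 2 * ((z - 1) * (zb - 1)) = (z + 1) * (zb + 1)) :
    SpecializesTo S (z * (1 - ρ ^ 2)) (-2 * (X + 1)) := by
  refine .of_mul (((SpecializesTo.ofNat 2).neg.mul h.add).congr ?_ (mul_one _).symm) h.sub_one_mul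
    isUnit_one
  linear_combination z * ι * ιb * hρ + 2 * (z + zb) * ιb * h.mul_inv

theorem mul_one_sub_ratio_pow_three (h : RecedesAlong S z zb ι ιb X)
    (hρ : ρ ^ 2 * ((z - 1) * (zb - 1)) = (z + 1) * (zb + 1)) (hρ1 : SpecializesTo S ρ 1)
    (h2 : IsUnit (1 + 1 : C)) : SpecializesTo S (z * (1 - ρ ^ 3)) (-3 * (X + 1)) := by
  refine .of_mul (((h.mul_one_sub_ratio_sq hρ).mul
    ((SpecializesTo.one.add hρ1).add (hρ1.pow 2))).congr ?_ ?_) (SpecializesTo.one.add hρ1) h2 <;>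
  ring

theorem mul_one_sub_ratio_pow_five (h : RecedesAlong S z zb ι ιb X)
    (hρ : ρ ^ 2 * ((z - 1) * (zb - 1)) = (z + 1) * (zb + 1)) (hρ1 : SpecializesTo S ρ 1)
    (h2 : IsUnit (1 + 1 : C)) : SpecializesTo S (z * (1 - ρ ^ 5)) (-5 * (X + 1)) := by
  refine .of_mul (((h.mul_one_sub_ratio_sq hρ).mul
    ((((SpecializesTo.one.add hρ1).add (hρ1.pow 2)).add (hρ1.pow 3)).add (hρ1.pow 4))).congr ?_ ?_)
    (SpecializesTo.one.add hρ1) h2 <;>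
  ring

theorem rigidityDefect_leading_of_ratio_one (h : RecedesAlong S z zb ι ιb X)
    (hD : rigidityDefect j w z zb p pb ρ = 0)
    (hρ : ρ ^ 2 * ((z - 1) * (zb - 1)) = (z + 1) * (zb + 1)) (hρ1 : SpecializesTo S ρ 1)
    (h2 : IsUnit (1 + 1 : C)) (hj : SpecializesTo S j j₀) (hw : SpecializesTo S w W)
    (hp : SpecializesTo S (p * ι) 0) (hpb : SpecializesTo S (pb * ιb) 0) :
    24 * (j₀ * W * (X ^ 2 - 1)) = 0 := by
  have hd := h.sub
  have ht := h.add
  have ha := h.add_one_mul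
  have hP := h.add_velocity hp hpb
  have h3 := h.mul_one_sub_ratio_pow_three hρ hρ1 h2
  have h5 := h.mul_one_sub_ratio_pow_five hρ hρ1 h2
  have hX := h.quotient
  have hιb := h.conj_inv
  have key : SpecializesTo S
      (6 * j * w * (z * (1 - ρ ^ 3)) * ((z - zb) * ιb) * ((z + 1) * ι * ((zb + 1) * ιb))
        + 3 * (p * ι + pb * ιb) *
          ((z + zb) * ιb * (z * (1 - ρ ^ 5)) + z * ιb * 2 * (1 + ρ ^ 5))
        + 3 * ((p + pb) * ιb - j * w * ((z - zb) * ιb)) *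
          ((z + zb) * ιb * (1 + ρ ^ 5) + ιb * 2 * (1 - ρ ^ 5))
        - 2 * (z * (1 - ρ ^ 3)) * ((z + 1) * ι * ((zb + 1) * ιb)) * ((p + pb) * ιb))
      (6 * j₀ * W * (-3 * (X + 1)) * (X - 1) * 1
        + 3 * (0 + 0) * ((X + 1) * (-5 * (X + 1)) + X * 2 * (1 + 1 ^ 5))
        + 3 * (0 - j₀ * W * (X - 1)) * ((X + 1) * (1 + 1 ^ 5) + 0 * 2 * (1 - 1 ^ 5))
        - 2 * (-3 * (X + 1)) * 1 * 0) := by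
    refine .sub (.add (.add ?_ ?_) ?_) ?_ <;>
      apply_rules [SpecializesTo.add, SpecializesTo.sub, SpecializesTo.mul, SpecializesTo.pow,
        SpecializesTo.one, SpecializesTo.ofNat]
  have h0 := key.unique (SpecializesTo.zero.congr ?_ rfl)
  · linear_combination -h0
  · rw [rigidityDefect] at hD
    linear_combination -ιb ^ 2 * hD
      + (-3 * ((z + zb) * (1 - ρ ^ 5) + 2 * (1 + ρ ^ 5)) * p * ιb
        + 2 * (1 - ρ ^ 3) * ((z + 1) * (zb + 1)) * (p + pb) * ιb ^ 2
        - 6 * j * w * (1 - ρ ^ 3) * (z - zb) * ((z + 1) * (zb + 1)) * ιb ^ 2) * h.mul_inv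
      + 3 * ((z + zb) * (1 - ρ ^ 5) + 2 * (1 + ρ ^ 5)) * p * ιb * h.conj_mul_inv

theorem rigidityDefect_leading_of_ratio_neg_one (h : RecedesAlong S z zb ι ιb X)
    (hD : rigidityDefect j w z zb p pb ρ = 0) (hρ : SpecializesTo S ρ (-1))
    (hj : SpecializesTo S j j₀) (hw : SpecializesTo S w W)
    (hp : SpecializesTo S (p * ι) 0) (hpb : SpecializesTo S (pb * ιb) 0) :
    12 * (j₀ * W * (X - 1)) = 0 := by
  have hd := h.sub
  have ht := h.add
  have ha := h.add_one_mul
  have hα := h.inv.add_one_mul_inv h.mul_inv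
  have hβ := h.inv.sub_one_mul_inv h.mul_inv
  have hαb := h.conj_inv.add_one_mul_inv h.conj_mul_inv
  have hβb := h.conj_inv.sub_one_mul_inv h.conj_mul_inv
  have hP := h.add_velocity hp hpb
  have hι := h.inv
  have hιb := h.conj_inv
  have key : SpecializesTo S
      (6 * j * w * (1 - ρ ^ 3) * ((z - zb) * ιb) * ((z + 1) * ι * ((zb + 1) * ιb))
        + 3 * (p * ι * ((zb + 1) * ιb) + pb * ιb * ((z + 1) * ι) - j * w * ((z - zb) * ιb * ι)) *
          ((z + zb) * ιb + 2 * ιb)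
        - 3 * ρ ^ 5 *
          (p * ι * ((zb - 1) * ιb) + pb * ιb * ((z - 1) * ι) + j * w * ((z - zb) * ιb * ι)) *
          ((z + zb) * ιb - 2 * ιb)
        - 2 * (1 - ρ ^ 3) * ((z + 1) * ι * ((zb + 1) * ιb)) * ((p + pb) * ιb))
      (6 * j₀ * W * (1 - (-1) ^ 3) * (X - 1) * 1
        + 3 * (0 * 1 + 0 * 1 - j₀ * W * ((X - 1) * 0)) * (X + 1 + 2 * 0)
        - 3 * (-1) ^ 5 * (0 * 1 + 0 * 1 + j₀ * W * ((X - 1) * 0)) * (X + 1 - 2 * 0)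
        - 2 * (1 - (-1) ^ 3) * 1 * 0) := by
    refine .sub (.sub (.add ?_ ?_) ?_) ?_ <;>
      apply_rules [SpecializesTo.add, SpecializesTo.sub, SpecializesTo.mul, SpecializesTo.pow,
        SpecializesTo.one, SpecializesTo.ofNat]
  have h0 := key.unique (SpecializesTo.zero.congr ?_ rfl)
  · linear_combination h0
  · rw [rigidityDefect] at hD
    linear_combination -ι * ιb ^ 2 * hD

end RecedesAlong

end RigidityDefect

/-- First order jets, with values in `A`, of a motion of three equal masses two of which keep their
distance. In the frame in which these two rest at `1` and `-1`, the third body is at `z` and has the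
inertial velocity `p`, while `zb` and `pb` are the conjugates, `w` is the angular velocity, `u` and
`v` are the inverses of the distances of the third body from `-1` and `1`, `ρ` is the quotient
`v / u`, `j` is the imaginary unit, and `L`, `E` are the values of the angular momentum and energy
integrals. A dual number stands for a quantity and its time derivative. -/
structure RigidPairJet (A : Type*) [CommRing A] where
  (j κ L E u v : A)
  (z zb p pb w ρ : DualNumber A)
  j_sq : j ^ 2 = -1
  u_sq : u ^ 2 * ((z.fst + 1) * (zb.fst + 1)) = 1
  v_sq : v ^ 2 * ((z.fst - 1) * (zb.fst - 1)) = 1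
  ρ_sq : ρ ^ 2 * ((z - 1) * (zb - 1)) = (z + 1) * (zb + 1)
  z_snd : z.snd = p.fst - j * w.fst * z.fst
  zb_snd : zb.snd = pb.fst + j * w.fst * zb.fst
  p_snd : p.snd = -(j * w.fst * p.fst) - 6 * κ * (u ^ 3 * (z.fst + 1) + v ^ 3 * (z.fst - 1))
  pb_snd : pb.snd = j * w.fst * pb.fst - 6 * κ * (u ^ 3 * (zb.fst + 1) + v ^ 3 * (zb.fst - 1))
  w_snd : w.snd = j * κ * ((u ^ 3 - v ^ 3) * (z.fst - zb.fst))
  angular_momentum : zb.fst * p.fst - z.fst * pb.fst + 6 * j * w.fst = L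
  energy : p.fst * pb.fst - 12 * κ * (u + v) + 3 * w.fst ^ 2 = E
  rigidity : w.fst ^ 2 = κ * (1 + (u ^ 3 * (z.fst + 1) + u ^ 3 * (zb.fst + 1))
    - (v ^ 3 * (z.fst - 1) + v ^ 3 * (zb.fst - 1)))
  rigidity_deriv : rigidityDefect (inl j) w z zb p pb ρ = 0

namespace RigidPairJet

section CommRing

variable {A : Type*} [CommRing A]

/-- The complex conjugate of a jet. -/
def conj (D : RigidPairJet A) : RigidPairJet A where
  j := -D.j
  κ := D.κ
  L := -D.L
  E := D.E
  u := D.u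
  v := D.v
  z := D.zb
  zb := D.z
  p := D.pb
  pb := D.p
  w := D.w
  ρ := D.ρ
  j_sq := by rw [neg_sq, D.j_sq]
  u_sq := by linear_combination D.u_sq
  v_sq := by linear_combination D.v_sq
  ρ_sq := by linear_combination D.ρ_sq
  z_snd := by rw [D.zb_snd]; ring
  zb_snd := by rw [D.z_snd]; ring
  p_snd := by rw [D.pb_snd]; ring
  pb_snd := by rw [D.p_snd]; ring
  w_snd := by rw [D.w_snd]; ring
  angular_momentum := by linear_combination -D.angular_momentum
  energy := by linear_combination D.energy
  rigidity := by linear_combination D.rigidity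
  rigidity_deriv := by
    have h := D.rigidity_deriv
    rw [rigidityDefect] at h ⊢
    rw [inl_neg]
    linear_combination h

theorem ρ_sq_fst (D : RigidPairJet A) :
    D.ρ.fst ^ 2 * ((D.z.fst - 1) * (D.zb.fst - 1)) = (D.z.fst + 1) * (D.zb.fst + 1) := by
  simpa only [map_mul, map_add, map_sub, map_pow, map_one, fstHom_apply] using
    congrArg (fstHom A A A) D.ρ_sq

theorem rigidity_deriv_fst (D : RigidPairJet A) :
    rigidityDefect D.j D.w.fst D.z.fst D.zb.fst D.p.fst D.pb.fst D.ρ.fst = 0 := by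
  simpa only [map_rigidityDefect, map_zero, fstHom_apply, fst_inl] using
    congrArg (fstHom A A A) D.rigidity_deriv

end CommRing

section Field

variable {K : Type*} [Field K]

theorem ρ_fst_ne_zero (D : RigidPairJet K) : D.ρ.fst ≠ 0 := by
  intro h
  have hz := D.ρ_sq_fst
  rw [h, zero_pow two_ne_zero, zero_mul] at hz
  simpa [← hz] using D.u_sq

/-- The jet seen after a half turn, which interchanges the two bodies of the rigid pair. -/
def swap (D : RigidPairJet K) : RigidPairJet K where
  j := D.j
  κ := D.κ
  L := D.L
  E := D.E
  u := D.v
  v := D.u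
  z := -D.z
  zb := -D.zb
  p := -D.p
  pb := -D.pb
  w := D.w
  ρ := D.ρ⁻¹
  j_sq := D.j_sq
  u_sq := by simp only [fst_neg]; linear_combination D.v_sq
  v_sq := by simp only [fst_neg]; linear_combination D.u_sq
  ρ_sq := by
    have h := TrivSqZeroExt.mul_inv_cancel D.ρ_fst_ne_zero
    linear_combination -D.ρ⁻¹ ^ 2 * D.ρ_sq + (D.z - 1) * (D.zb - 1) * (D.ρ * D.ρ⁻¹ + 1) * h
  z_snd := by simp only [fst_neg, snd_neg]; rw [D.z_snd]; ring
  zb_snd := by simp only [fst_neg, snd_neg]; rw [D.zb_snd]; ring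
  p_snd := by simp only [fst_neg, snd_neg]; rw [D.p_snd]; ring
  pb_snd := by simp only [fst_neg, snd_neg]; rw [D.pb_snd]; ring
  w_snd := by simp only [fst_neg]; rw [D.w_snd]; ring
  angular_momentum := by simp only [fst_neg]; linear_combination D.angular_momentum
  energy := by simp only [fst_neg]; linear_combination D.energy
  rigidity := by simp only [fst_neg]; linear_combination D.rigidity
  rigidity_deriv :=
    rigidityDefect_swap D.ρ_sq (TrivSqZeroExt.mul_inv_cancel D.ρ_fst_ne_zero) D.rigidity_deriv

end Field

end RigidPairJet

section DualNumber

@[simp]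
theorem fst_ofNat_dualNumber {A : Type*} [CommRing A] (n : ℕ) [n.AtLeastTwo] :
    fst (ofNat(n) : DualNumber A) = OfNat.ofNat n :=
  map_ofNat (fstHom A A A) n

@[simp]
theorem snd_ofNat_dualNumber {A : Type*} [CommRing A] (n : ℕ) [n.AtLeastTwo] :
    snd (ofNat(n) : DualNumber A) = 0 :=
  snd_natCast n

variable {k : Type*} [Field k] [CharZero k] {R : DualNumber k} {c y M : k}

theorem eq_zero_of_sq_eq_neg_one (hR : R ^ 2 = -1)
    (h : (1 + R) * (inl M + inr (-M ^ 2) + 3 * inl c) = 0) : c = 0 := by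
  have hunit : IsUnit (2 : DualNumber k) :=
    isUnit_iff_isUnit_fst.2 (by simp)
  have h0 : inl M + inr (-M ^ 2) + 3 * inl c = (0 : DualNumber k) := hunit.mul_right_eq_zero.1 <| by
    linear_combination (1 - R) * h + (inl M + inr (-M ^ 2) + 3 * inl c) * hR
  have hM : M = 0 := by simpa using congrArg snd h0
  simpa [hM] using congrArg fst h0

theorem septic_derivative_ne_zero {r : k} (h : r ^ 7 + 3 * r ^ 5 - 3 * r ^ 2 - 1 = 0) :
    7 * r ^ 6 + 15 * r ^ 4 - 6 * r ≠ 0 := fun hderiv => by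
  -- A Bézout identity for the septic and its derivative.
  have : (42496 : k) = 0 := by
    linear_combination (-42496 - 28350 * r + 30930 * r ^ 2 + 49410 * r ^ 3 + 17325 * r ^ 4
      + 30261 * r ^ 5) * h + (4725 + 16093 * r + 5940 * r ^ 2 - 6540 * r ^ 3 - 10764 * r ^ 4
      - 2475 * r ^ 5 - 4323 * r ^ 6) * hderiv
  norm_num at this

theorem snd_eq_zero_of_septic (h : R ^ 7 + 3 * R ^ 5 - 3 * R ^ 2 - 1 = 0) : R.snd = 0 := by
  have hfst : R.fst ^ 7 + 3 * R.fst ^ 5 - 3 * R.fst ^ 2 - 1 = 0 := by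
    simpa using congrArg fst h
  have hsnd : (7 * R.fst ^ 6 + 15 * R.fst ^ 4 - 6 * R.fst) * R.snd = 0 := by
    have hsnd := congrArg snd h
    simp only [snd_sub, snd_add, snd_mul, snd_pow, snd_one, snd_zero, fst_pow, fst_ofNat_dualNumber,
      snd_ofNat_dualNumber, smul_eq_mul, nsmul_eq_mul, MulOpposite.smul_eq_mul_unop,
      MulOpposite.unop_op, Nat.pred_eq_sub_one, Nat.reduceSub, Nat.cast_ofNat] at hsnd
    linear_combination hsnd
  exact (mul_eq_zero.1 hsnd).resolve_left (septic_derivative_ne_zero hfst)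

theorem mul_eq_zero_of_septic
    (hR : R ^ 2 * (inl y + inr (c * y) - 1) = inl y + inr (c * y) + 1)
    (h : R ^ 7 + 3 * R ^ 5 - 3 * R ^ 2 - 1 = 0) : c * y = 0 := by
  have hfst : R.fst ^ 2 * (y - 1) = y + 1 := by simpa using congrArg fst hR
  have hsnd : R.fst ^ 2 * (c * y) = c * y := by
    simpa [snd_pow, snd_eq_zero_of_septic h] using congrArg snd hR
  have h2 : 2 * (c * y) = 0 := by linear_combination (y - 1) * hsnd - c * y * hfst
  exact (mul_eq_zero.1 h2).resolve_left two_ne_zero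

theorem eq_zero_of_leading_of_ne_zero (hy : y ≠ 0)
    (hR : R ^ 2 * (inl y + inr (c * y) - 1) = inl y + inr (c * y) + 1)
    (h : 6 * inl c * (1 - R ^ 3) * (inl y + inr (c * y) + 1) =
      3 * inl c + 3 * R ^ 5 * inl c) : c = 0 := by
  by_contra hc
  have hunit : IsUnit (3 * inl c : DualNumber k) := isUnit_iff_isUnit_fst.2 (by simp [hc])
  refine mul_ne_zero hc hy (mul_eq_zero_of_septic hR (hunit.mul_right_eq_zero.1 ?_))
  linear_combination -(R ^ 2 - 1) * h + 6 * inl c * (1 - R ^ 3) * hR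

theorem eq_zero_of_leading (hyM : y * M = 0)
    (hR : R ^ 2 * (inl y + inr (c * y) - 1) = inl y + inr (c * y) + 1)
    (h : 6 * inl c * (1 - R ^ 3) * (inl y + inr (c * y) + 1) =
      -3 * ((inl M + inr (-M ^ 2)) * (inl y + inr (c * y) + 1) - inl c)
        + 3 * R ^ 5 * ((inl M + inr (-M ^ 2)) * (inl y + inr (c * y) - 1) + inl c)
        + 2 * (1 - R ^ 3) * (inl y + inr (c * y) + 1) * (inl M + inr (-M ^ 2))) : c = 0 := by
  by_cases hy : y = 0
  · subst hy
    simp only [mul_zero, inr_zero, inl_zero, add_zero, zero_add, zero_sub, mul_one] at hR h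
    have hR' : R ^ 2 = -1 := by linear_combination -hR
    refine eq_zero_of_sq_eq_neg_one (M := M) hR' ?_
    linear_combination h + (-3 * (inl M + inr (-M ^ 2)) * R ^ 3 + 3 * inl c * R ^ 3
      + (inl M + inr (-M ^ 2) + 3 * inl c) * R) * hR'
  · obtain rfl := (mul_eq_zero.1 hyM).resolve_left hy
    refine eq_zero_of_leading_of_ne_zero hy hR ?_
    simpa using h

theorem eq_one_or_eq_neg_one_of_sq_eq_one (h : R ^ 2 = 1) : R = 1 ∨ R = -1 := by
  have hfst : R.fst ^ 2 = 1 := by simpa only [fst_pow, fst_one] using congrArg fst h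
  have hsnd : 2 * R.fst * R.snd = 0 := by
    linear_combination (by simpa [sq] using congrArg snd h : R.fst * R.snd + R.snd * R.fst = 0)
  have hne : 2 * R.fst ≠ 0 := mul_ne_zero two_ne_zero fun h0 => by simp [h0] at hfst
  have hsnd : R.snd = 0 := (mul_eq_zero.1 hsnd).resolve_left hne
  exact (sq_eq_one_iff.1 hfst).imp (fun h => ext h hsnd) fun h => ext h (by simpa)

theorem eq_zero_of_sq_eq_one (h : (inl y + inr (c * y) : DualNumber k) ^ 2 = 1) : c = 0 := by
  have hfst : y ^ 2 = 1 := by simpa using congrArg fst h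
  have hsnd : 2 * c = 0 := by
    have hsnd : y * (c * y) + c * y * y = 0 := by simpa [sq] using congrArg snd h
    linear_combination hsnd - 2 * c * hfst
  exact (mul_eq_zero.1 hsnd).resolve_left two_ne_zero

end DualNumber

section Places

variable {K : Type*} [Field K] {V : ValuationSubring K}

theorem attraction_specializesAt_zero {u a b : K} (h : u ^ 2 * (a * b) = 1)
    (ha : SpecializesAt V a⁻¹ 0) (hb : b⁻¹ ∈ V) :
    SpecializesAt V u 0 ∧ SpecializesAt V (u ^ 3 * a) 0 ∧ SpecializesAt V (u ^ 3 * b) 0 := by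
  have hab : a * b ≠ 0 := right_ne_zero_of_mul_eq_one h
  obtain ⟨ha0, hb0⟩ := mul_ne_zero_iff.1 hab
  obtain ⟨β, hβ⟩ := SpecializesTo.exists_of_mem hb
  have hu : u ^ 2 = a⁻¹ * b⁻¹ := by rw [eq_div_of_mul_eq hab h]; field_simp
  have hu6 : u ^ 6 = (a⁻¹ * b⁻¹) ^ 3 := by rw [← hu]; ring
  refine ⟨.zero_of_pow two_ne_zero ((ha.mul hβ).congr hu.symm (zero_mul _)),
    .zero_of_pow two_ne_zero ((ha.mul (hβ.pow 3)).congr ?_ (zero_mul _)),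
    .zero_of_pow two_ne_zero (((ha.pow 3).mul hβ).congr ?_ (by simp))⟩ <;>
  rw [mul_pow, ← pow_mul, hu6] <;> field_simp

theorem momentum_specializesAt_zero {z zb p pb : K} (hz : z ∉ V) (hzb : zb ∈ V)
    (hl : zb * p - z * pb ∈ V) (he : p * pb ∈ V) : SpecializesAt V pb 0 := by
  have hz0 : z ≠ 0 := by rintro rfl; exact hz V.zero_mem
  have hι := SpecializesTo.inv_of_notMem hz
  obtain ⟨_, hzb⟩ := SpecializesTo.exists_of_mem hzb
  obtain ⟨_, hl⟩ := SpecializesTo.exists_of_mem hl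
  obtain ⟨_, he⟩ := SpecializesTo.exists_of_mem he
  have key : pb ^ 2 = z⁻¹ * (zb * (p * pb) - (zb * p - z * pb) * pb) := by field_simp; ring
  by_cases hpb : pb ∈ V
  · obtain ⟨_, hpb⟩ := SpecializesTo.exists_of_mem hpb
    exact .zero_of_pow two_ne_zero
      ((hι.mul ((hzb.mul he).sub (hl.mul hpb))).congr key.symm (zero_mul _))
  · have hpb0 : pb ≠ 0 := by rintro rfl; exact hpb V.zero_mem
    have hi := SpecializesTo.inv_of_notMem hpb
    have h1 : z⁻¹ * (zb * (p * pb) * pb⁻¹ ^ 2 - (zb * p - z * pb) * pb⁻¹) = 1 := by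
      field_simp; ring
    exact absurd (SpecializesTo.one.unique
      ((hι.mul (((hzb.mul he).mul (hi.pow 2)).sub (hl.mul hi))).congr h1 (zero_mul _))) one_ne_zero

theorem specializesAt_zero_of_sub_of_mul {x y : K} (h : SpecializesAt V (x - y) 0)
    (h' : SpecializesAt V (x * y) 0) :
    SpecializesAt V x 0 := by
  by_cases hx : x ∈ V
  · obtain ⟨_, hx⟩ := SpecializesTo.exists_of_mem hx
    exact .zero_of_pow two_ne_zero (((hx.mul h).add h').congr (by ring) (by simp))
  · have hx0 : x ≠ 0 := fun h => hx (h ▸ V.zero_mem)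
    refine absurd (h.add (h'.mul (SpecializesTo.inv_of_notMem hx))).mem ?_
    rwa [mul_right_comm, mul_inv_cancel₀ hx0, one_mul, sub_add_cancel]

theorem pow_three_dualSpecializesAt_zero [CharZero (IsLocalRing.ResidueField V)] {X : DualNumber K}
    (h : DualSpecializesAt V (X ^ 2) 0) : DualSpecializesAt V (X ^ 3) 0 := by
  have hX : SpecializesAt V X.fst 0 := .zero_of_pow two_ne_zero (h.1.congr (fst_pow X 2) rfl)
  refine ⟨(hX.pow 3).congr (fst_pow X 3).symm (zero_pow three_ne_zero), ?_⟩
  refine .of_mul ((((SpecializesTo.ofNat 3).mul hX).mul h.2).congr ?_ ?_) (.ofNat 2)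
    (isUnit_iff_ne_zero.2 two_ne_zero)
  · simp only [snd_pow, Nat.pred_eq_sub_one, Nat.add_one_sub_one, pow_one, smul_eq_mul,
      nsmul_eq_mul, Nat.cast_ofNat]
    ring
  · simp

namespace RigidPairJet

/-- At the place of `V`, where the imaginary unit has the value `j₀`, the third body is infinitely
far away, while the constants of the motion are finite and the gravitational parameter has the
nonzero value `κ₀`. -/
structure EscapesAt (D : RigidPairJet K) (V : ValuationSubring K)
    (j₀ κ₀ : IsLocalRing.ResidueField V) : Prop where
  j : SpecializesAt V D.j j₀
  κ : SpecializesAt V D.κ κ₀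
  κ_ne_zero : κ₀ ≠ 0
  L_mem : D.L ∈ V
  E_mem : D.E ∈ V
  z_notMem : D.z.fst ∉ V

/-- At the place of `V` the attraction that the rigid pair exerts on the third body vanishes. -/
structure AttractionVanishesAt (D : RigidPairJet K) (V : ValuationSubring K) : Prop where
  u : SpecializesAt V D.u 0
  v : SpecializesAt V D.v 0
  left : SpecializesAt V (D.u ^ 3 * (D.z.fst + 1)) 0
  left_conj : SpecializesAt V (D.u ^ 3 * (D.zb.fst + 1)) 0
  right : SpecializesAt V (D.v ^ 3 * (D.z.fst - 1)) 0
  right_conj : SpecializesAt V (D.v ^ 3 * (D.zb.fst - 1)) 0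

theorem AttractionVanishesAt.conj {D : RigidPairJet K} (h : D.AttractionVanishesAt V) :
    D.conj.AttractionVanishesAt V :=
  ⟨h.u, h.v, h.left_conj, h.left, h.right_conj, h.right⟩

namespace EscapesAt

variable {D : RigidPairJet K} {j₀ κ₀ y w₀ M : IsLocalRing.ResidueField V}

theorem conj (h : D.EscapesAt V j₀ κ₀) (hzb : D.zb.fst ∉ V) : D.conj.EscapesAt V (-j₀) κ₀ :=
  ⟨h.j.neg, h.κ, h.κ_ne_zero, V.neg_mem _ h.L_mem, h.E_mem, hzb⟩

theorem swap (h : D.EscapesAt V j₀ κ₀) : D.swap.EscapesAt V j₀ κ₀ :=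
  ⟨h.j, h.κ, h.κ_ne_zero, h.L_mem, h.E_mem,
    fun hz => h.z_notMem (by simpa [RigidPairJet.swap] using hz)⟩

theorem z_ne_zero (h : D.EscapesAt V j₀ κ₀) : D.z.fst ≠ 0 :=
  fun hz => h.z_notMem (hz ▸ V.zero_mem)

theorem inv_z (h : D.EscapesAt V j₀ κ₀) : SpecializesAt V D.z.fst⁻¹ 0 :=
  .inv_of_notMem h.z_notMem

theorem inv_z_add_one (h : D.EscapesAt V j₀ κ₀) : SpecializesAt V (D.z.fst + 1)⁻¹ 0 :=
  .inv_of_notMem fun hz => h.z_notMem (by simpa using sub_mem hz V.one_mem)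

theorem inv_z_sub_one (h : D.EscapesAt V j₀ κ₀) : SpecializesAt V (D.z.fst - 1)⁻¹ 0 :=
  .inv_of_notMem fun hz => h.z_notMem (by simpa using add_mem hz V.one_mem)

theorem j_ne_zero (h : D.EscapesAt V j₀ κ₀) : j₀ ≠ 0 := by
  rintro rfl
  have h1 := (h.j.pow 2).unique (SpecializesTo.one.neg.congr D.j_sq.symm rfl)
  simp at h1

theorem attractionVanishesAt (h : D.EscapesAt V j₀ κ₀) (ha : (D.zb.fst + 1)⁻¹ ∈ V)
    (hb : (D.zb.fst - 1)⁻¹ ∈ V) : D.AttractionVanishesAt V := by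
  obtain ⟨hu, hl, hl'⟩ := attraction_specializesAt_zero D.u_sq h.inv_z_add_one ha
  obtain ⟨hv, hr, hr'⟩ := attraction_specializesAt_zero D.v_sq h.inv_z_sub_one hb
  exact ⟨hu, hv, hl, hl', hr, hr'⟩

theorem exists_angular_velocity (h : D.EscapesAt V j₀ κ₀) (hA : D.AttractionVanishesAt V) :
    ∃ w₀, DualSpecializesAt V D.w (inl w₀) ∧ w₀ ≠ 0 := by
  obtain ⟨w₀, hw, hw₀⟩ := SpecializesTo.exists_of_pow two_ne_zero
    ((h.κ.mul ((SpecializesTo.one.add (hA.left.add hA.left_conj)).sub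
      (hA.right.add hA.right_conj))).congr D.rigidity.symm rfl)
  refine ⟨w₀, ⟨hw, ((h.j.mul h.κ).mul ((hA.left.sub hA.left_conj).sub
    (hA.right.sub hA.right_conj))).congr ?_ (by simp)⟩, ?_⟩
  · rw [D.w_snd]; ring
  · rintro rfl
    exact h.κ_ne_zero (by simpa using hw₀.symm)

theorem integrals_mem (h : D.EscapesAt V j₀ κ₀) {t : K} (ht : t ∈ V) (hw : D.w.fst * t ∈ V)
    (huv : (D.u + D.v) * t ^ 2 ∈ V) :
    D.zb.fst * (D.p.fst * t) - D.z.fst * (D.pb.fst * t) ∈ V ∧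
      D.p.fst * t * (D.pb.fst * t) ∈ V := by
  have hl : D.zb.fst * (D.p.fst * t) - D.z.fst * (D.pb.fst * t) =
      D.L * t - 6 * D.j * (D.w.fst * t) := by linear_combination t * D.angular_momentum
  have he : D.p.fst * t * (D.pb.fst * t) =
      D.E * t ^ 2 + 12 * D.κ * ((D.u + D.v) * t ^ 2) - 3 * (D.w.fst * t) ^ 2 := by
    linear_combination t ^ 2 * D.energy
  rw [hl, he]
  exact ⟨sub_mem (mul_mem h.L_mem ht) (mul_mem (mul_mem (ofNat_mem V 6) h.j.mem) hw),
    sub_mem (add_mem (mul_mem h.E_mem (pow_mem ht 2))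
      (mul_mem (mul_mem (ofNat_mem V 12) h.κ.mem) huv)) (mul_mem (ofNat_mem V 3) (pow_mem hw 2))⟩

theorem momentum_scaled (h : D.EscapesAt V j₀ κ₀) {t : K} (hzb : D.zb.fst ∈ V) (ht : t ∈ V)
    (hw : D.w.fst * t ∈ V) (huv : (D.u + D.v) * t ^ 2 ∈ V) :
    SpecializesAt V (D.pb.fst * t) 0 ∧
      SpecializesAt V (D.zb.fst * (D.p.fst * D.z.fst⁻¹ * t)) 0 := by
  obtain ⟨hl, he⟩ := h.integrals_mem ht hw huv
  have hpb := momentum_specializesAt_zero h.z_notMem hzb hl he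
  obtain ⟨l, hl⟩ := SpecializesTo.exists_of_mem hl
  refine ⟨hpb, (hpb.add (h.inv_z.mul hl)).congr ?_ (by simp)⟩
  have := h.z_ne_zero
  field_simp
  ring

theorem inv_z_dual (h : D.EscapesAt V j₀ κ₀) (hw : D.w.fst ∈ V)
    (hp : D.p.fst * D.z.fst⁻¹ ∈ V) : DualSpecializesAt V D.z⁻¹ 0 := by
  obtain ⟨_, hw⟩ := SpecializesTo.exists_of_mem hw
  obtain ⟨_, hp⟩ := SpecializesTo.exists_of_mem hp
  refine ⟨h.inv_z, (h.inv_z.mul (hp.sub (h.j.mul hw))).neg.congr ?_ (by simp)⟩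
  have := h.z_ne_zero
  simp only [snd_inv, MulOpposite.op_inv, D.z_snd, smul_eq_mul, MulOpposite.smul_eq_mul_unop,
    MulOpposite.unop_inv, MulOpposite.unop_op, neg_inj]
  field_simp

theorem p_div_z_dual (h : D.EscapesAt V j₀ κ₀) (hp : SpecializesAt V (D.p.fst * D.z.fst⁻¹) M)
    (hA : D.u ^ 3 * (D.z.fst + 1) + D.v ^ 3 * (D.z.fst - 1) ∈ V) :
    DualSpecializesAt V (D.p * D.z⁻¹) (inl M + inr (-M ^ 2)) := by
  obtain ⟨_, hA⟩ := SpecializesTo.exists_of_mem hA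
  refine ⟨hp.congr rfl (by simp),
    (((((SpecializesTo.ofNat 6).neg.mul h.κ).mul hA).mul h.inv_z).sub (hp.pow 2)).congr ?_
      (by simp)⟩
  have := h.z_ne_zero
  simp only [neg_mul, snd_mul, snd_inv, MulOpposite.op_inv, D.z_snd, smul_eq_mul,
    MulOpposite.smul_eq_mul_unop, MulOpposite.unop_inv, MulOpposite.unop_op, mul_neg, fst_inv,
    D.p_snd]
  field_simp
  ring

theorem zb_dual (h : D.EscapesAt V j₀ κ₀) (hzb : SpecializesAt V D.zb.fst y)
    (hw : SpecializesAt V D.w.fst w₀)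
    (hpb : SpecializesAt V D.pb.fst 0) : DualSpecializesAt V D.zb (inl y + inr (j₀ * w₀ * y)) :=
  ⟨hzb.congr rfl (by simp), (hpb.add ((h.j.mul hw).mul hzb)).congr D.zb_snd.symm (by simp)⟩

theorem pb_dual (h : D.EscapesAt V j₀ κ₀) (hw : SpecializesAt V D.w.fst w₀)
    (hpb : SpecializesAt V D.pb.fst 0)
    (hA : SpecializesAt V (D.u ^ 3 * (D.zb.fst + 1) + D.v ^ 3 * (D.zb.fst - 1)) 0) :
    DualSpecializesAt V D.pb 0 :=
  ⟨hpb, (((h.j.mul hw).mul hpb).sub (((SpecializesTo.ofNat 6).mul h.κ).mul hA)).congr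
    D.pb_snd.symm (by simp)⟩

theorem mul_inv_z (h : D.EscapesAt V j₀ κ₀) : D.z * D.z⁻¹ = 1 :=
  TrivSqZeroExt.mul_inv_cancel h.z_ne_zero

section Finite

theorem exists_ratio_sq (h : D.EscapesAt V j₀ κ₀) (hzb : SpecializesAt V D.zb.fst y)
    (hb : y - 1 ≠ 0) :
    ∃ R, SpecializesAt V D.ρ.fst R ∧ R ^ 2 * (y - 1) = y + 1 := by
  obtain ⟨R₂, hρ, hR₂⟩ := exists_ratio_sq_specializesTo (mul_inv_cancel₀ h.z_ne_zero) h.inv_z hzb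
    D.ρ_sq_fst (isUnit_iff_ne_zero.2 hb)
  obtain ⟨R, hR, rfl⟩ := SpecializesTo.exists_of_pow two_ne_zero hρ
  exact ⟨R, hR, hR₂⟩

variable [CharZero (IsLocalRing.ResidueField V)]

theorem exists_ratio_sq_dual (h : D.EscapesAt V j₀ κ₀) (hι : DualSpecializesAt V D.z⁻¹ 0)
    {Y : DualNumber (IsLocalRing.ResidueField V)} (hzb : DualSpecializesAt V D.zb Y)
    (ha : Y.fst + 1 ≠ 0) (hb : Y.fst - 1 ≠ 0) :
    ∃ R, DualSpecializesAt V D.ρ R ∧ R ^ 2 * (Y - 1) = Y + 1 := by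
  obtain ⟨R₂, hρ₂, hR₂⟩ := exists_ratio_sq_specializesTo h.mul_inv_z hι hzb D.ρ_sq
    (isUnit_iff_isUnit_fst.2 (isUnit_iff_ne_zero.2 (by simpa using hb)))
  obtain ⟨r, hρ, hr⟩ := h.exists_ratio_sq hzb.1 hb
  have hr0 : r ≠ 0 := by
    rintro rfl
    exact ha (by simpa using hr.symm)
  obtain ⟨R, hρ, rfl, -⟩ := hρ₂.dual_of_sq hρ
    (isUnit_iff_ne_zero.2 (mul_ne_zero two_ne_zero hr0))
  exact ⟨R, hρ, hR₂⟩

theorem p_div_z_mem (h : D.EscapesAt V j₀ κ₀) (hzb : SpecializesAt V D.zb.fst y) (hb : y - 1 ≠ 0)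
    (hw : SpecializesAt V D.w.fst w₀) (hpb : SpecializesAt V D.pb.fst 0)
    (hp : SpecializesAt V (D.zb.fst * (D.p.fst * D.z.fst⁻¹)) 0) : D.p.fst * D.z.fst⁻¹ ∈ V := by
  by_contra hμ
  have hμ0 : D.p.fst * D.z.fst⁻¹ ≠ 0 := fun h => hμ (h ▸ V.zero_mem)
  have hν := SpecializesTo.inv_of_notMem hμ
  obtain rfl : y = 0 := hzb.unique ((hp.mul hν).congr (mul_inv_cancel_right₀ hμ0 _) (mul_zero 0))
  obtain ⟨R, hρ, hR⟩ := h.exists_ratio_sq hzb hb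
  have key := rigidityDefect_leading D.rigidity_deriv_fst (mul_inv_cancel₀ h.z_ne_zero) h.inv_z
    h.j hzb (hw.mul hν) (SpecializesTo.one.congr (mul_inv_cancel₀ hμ0).symm rfl)
    ((hpb.mul hν).congr rfl (mul_zero 0)) (hρ.pow 3) (hρ.pow 5)
  have hR3 : R ^ 3 = 1 := by linear_combination -key - 3 * R ^ 3 * hR
  obtain rfl : R = -1 := by linear_combination -R * hR - hR3
  norm_num at hR

theorem false_of_conj_finite (h : D.EscapesAt V j₀ κ₀) (hzb : SpecializesAt V D.zb.fst y)
    (ha : y + 1 ≠ 0) (hb : y - 1 ≠ 0) : False := by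
  have hA := h.attractionVanishesAt ((hzb.add .one).inv ha).mem ((hzb.sub .one).inv hb).mem
  obtain ⟨w₀, hw, hw₀⟩ := h.exists_angular_velocity hA
  have hw1 : SpecializesAt V D.w.fst w₀ := hw.1
  obtain ⟨hpb, hp⟩ := h.momentum_scaled hzb.mem V.one_mem (by simpa using hw1.mem)
    (by simpa using (hA.u.add hA.v).mem)
  rw [mul_one] at hpb hp
  have hμ := h.p_div_z_mem hzb hb hw1 hpb hp
  obtain ⟨M, hM⟩ := SpecializesTo.exists_of_mem hμ
  have hιε := h.inv_z_dual hw1.mem hμ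
  have hzbε := h.zb_dual hzb hw1 hpb
  have hpε := h.p_div_z_dual hM (hA.left.add hA.right).mem
  have hpbε := h.pb_dual hw1 hpb ((hA.left_conj.add hA.right_conj).congr rfl (add_zero 0))
  obtain ⟨R, hρ, hR⟩ := h.exists_ratio_sq_dual hιε hzbε (by simpa using ha) (by simpa using hb)
  have key := rigidityDefect_leading (t := 1) D.rigidity_deriv h.mul_inv_z hιε h.j.inl hzbε
    (hw.congr (mul_one _).symm rfl) (hpε.congr (mul_one _).symm rfl)
    (hpbε.congr (mul_one _).symm rfl) (hρ.pow 3) (hρ.pow 5)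
  refine mul_ne_zero h.j_ne_zero hw₀ (eq_zero_of_leading ((hzb.mul hM).unique hp) hR ?_)
  rw [inl_mul]
  linear_combination key

end Finite

section Isotropic

theorem isotropic_attraction (h : D.EscapesAt V j₀ κ₀) (hzb : SpecializesAt V D.zb.fst (-1))
    (hB : SpecializesAt V (D.v ^ 3 * (D.z.fst - 1) + D.v ^ 3 * (D.zb.fst - 1)) 0) {t : K}
    {T W : IsLocalRing.ResidueField V} (ht : SpecializesAt V t T)
    (hw : SpecializesAt V (D.w.fst * t) W) :
    SpecializesAt V (D.u ^ 3 * (D.z.fst + 1) * t ^ 2) (W ^ 2 * κ₀⁻¹ - T ^ 2) := by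
  have hδ : SpecializesAt V (D.zb.fst + 1) 0 := (hzb.add .one).congr rfl (neg_add_cancel 1)
  refine .of_mul (((hw.pow 2).add (h.κ.mul ((hB.sub .one).mul (ht.pow 2)))).congr ?_ ?_)
    (h.κ.mul (SpecializesTo.one.add (hδ.mul h.inv_z_add_one)))
    (isUnit_iff_ne_zero.2 (by simpa using h.κ_ne_zero))
  · have ha : (D.z.fst + 1) * (D.z.fst + 1)⁻¹ = 1 :=
      mul_inv_cancel₀ (left_ne_zero_of_mul (right_ne_zero_of_mul_eq_one D.u_sq))
    linear_combination t ^ 2 * D.rigidity - D.u ^ 3 * t ^ 2 * D.κ * (D.zb.fst + 1) * ha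
  · have := h.κ_ne_zero
    field_simp
    ring

theorem isotropic_momentum (h : D.EscapesAt V j₀ κ₀) (hzb : SpecializesAt V D.zb.fst (-1))
    (hv : SpecializesAt V D.v 0)
    (hB : SpecializesAt V (D.v ^ 3 * (D.z.fst - 1) + D.v ^ 3 * (D.zb.fst - 1)) 0) {t : K}
    {T W : IsLocalRing.ResidueField V} (ht : SpecializesAt V t T)
    (hw : SpecializesAt V (D.w.fst * t) W) :
    SpecializesAt V (D.pb.fst * t) 0 ∧ SpecializesAt V (D.p.fst * D.z.fst⁻¹ * t) 0 := by
  have huv := ((h.isotropic_attraction hzb hB ht hw).mul (hzb.add .one)).add (hv.mul (ht.pow 2))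
  obtain ⟨hpb, hp⟩ := h.momentum_scaled hzb.mem ht.mem hw.mem
    (huv.congr (by linear_combination D.u * t ^ 2 * D.u_sq) rfl).mem
  exact ⟨hpb, .of_mul (hp.congr (mul_comm _ _) (by simp)) hzb (by simp)⟩

variable [CharZero (IsLocalRing.ResidueField V)]

theorem isotropic_attraction_right (h : D.EscapesAt V j₀ κ₀) (hzb : SpecializesAt V D.zb.fst (-1)) :
    SpecializesAt V D.v 0 ∧ SpecializesAt V (D.v ^ 3 * (D.z.fst - 1)) 0 ∧
      SpecializesAt V (D.v ^ 3 * (D.zb.fst - 1)) 0 :=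
  attraction_specializesAt_zero D.v_sq h.inv_z_sub_one
    ((hzb.sub .one).inv (by norm_num)).mem

theorem isotropic_ratio (h : D.EscapesAt V j₀ κ₀) (hzb : SpecializesAt V D.zb.fst (-1)) :
    SpecializesAt V D.ρ.fst 0 := by
  obtain ⟨R, hρ, hR⟩ := h.exists_ratio_sq hzb (by norm_num)
  have hR0 : R = 0 := by
    have : R ^ 2 * 2 = 0 := by linear_combination -hR
    simpa using this
  exact hρ.congr rfl hR0

theorem isotropic_angular_velocity_scaled (h : D.EscapesAt V j₀ κ₀)
    (hzb : SpecializesAt V D.zb.fst (-1)) {t : K} {T W : IsLocalRing.ResidueField V}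
    (ht : SpecializesAt V t T) (hw : SpecializesAt V (D.w.fst * t) W) :
    W = 0 := by
  obtain ⟨hv, hr, hr'⟩ := h.isotropic_attraction_right hzb
  obtain ⟨hpb, hp⟩ := h.isotropic_momentum hzb hv ((hr.add hr').congr rfl (add_zero 0)) ht hw
  have hρ := h.isotropic_ratio hzb
  have key := rigidityDefect_leading D.rigidity_deriv_fst (mul_inv_cancel₀ h.z_ne_zero) h.inv_z
    h.j hzb hw hp hpb (hρ.pow 3) (hρ.pow 5)
  have h3 : 3 * (j₀ * W) = 0 := by linear_combination -key
  simpa [h.j_ne_zero] using h3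

theorem isotropic_angular_velocity (h : D.EscapesAt V j₀ κ₀) (hzb : SpecializesAt V D.zb.fst (-1)) :
    SpecializesAt V D.w.fst 0 := by
  have hw : D.w.fst ∈ V := by
    by_contra hw
    have hw0 : D.w.fst ≠ 0 := fun h => hw (h ▸ V.zero_mem)
    exact one_ne_zero (h.isotropic_angular_velocity_scaled hzb (.inv_of_notMem hw)
      (SpecializesTo.one.congr (mul_inv_cancel₀ hw0).symm rfl))
  obtain ⟨w₀, hw⟩ := SpecializesTo.exists_of_mem hw
  exact hw.congr rfl (h.isotropic_angular_velocity_scaled hzb .one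
    (hw.congr (mul_one _).symm rfl))

theorem isotropic_ratio_dual (h : D.EscapesAt V j₀ κ₀) (hι : DualSpecializesAt V D.z⁻¹ 0)
    (hzb : DualSpecializesAt V D.zb (-1)) : DualSpecializesAt V (D.ρ ^ 2) 0 := by
  have hu : IsUnit (-1 - 1 : DualNumber (IsLocalRing.ResidueField V)) :=
    isUnit_iff_isUnit_fst.2 (isUnit_iff_ne_zero.2 (by simp; norm_num))
  obtain ⟨R, hρ, hR⟩ := exists_ratio_sq_specializesTo h.mul_inv_z hι hzb D.ρ_sq hu
  exact hρ.congr rfl (hu.mul_left_eq_zero.1 (hR.trans (neg_add_cancel 1)))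

theorem false_of_conj_eq_neg_one (h : D.EscapesAt V j₀ κ₀)
    (hzb : SpecializesAt V D.zb.fst (-1)) : False := by
  obtain ⟨hv, hr, hr'⟩ := h.isotropic_attraction_right hzb
  have hw := h.isotropic_angular_velocity hzb
  have hw1 : SpecializesAt V (D.w.fst * 1) 0 := hw.congr (mul_one _).symm rfl
  have hB := (hr.add hr').congr rfl (add_zero 0)
  obtain ⟨hpb, hp⟩ := h.isotropic_momentum hzb hv hB .one hw1
  rw [mul_one] at hpb hp
  have hl : SpecializesAt V (D.u ^ 3 * (D.z.fst + 1)) (-1) :=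
    (h.isotropic_attraction hzb hB .one hw1).congr (by ring) (by simp)
  have hl' : SpecializesAt V (D.u ^ 3 * (D.zb.fst + 1)) 0 :=
    ((hl.mul (hzb.add .one)).mul h.inv_z_add_one).congr
      (by field_simp [left_ne_zero_of_mul (right_ne_zero_of_mul_eq_one D.u_sq)]) (mul_zero _)
  have hιε := h.inv_z_dual hw.mem hp.mem
  have hzbε : DualSpecializesAt V D.zb (-1) := (h.zb_dual hzb hw hpb).congr rfl (by simp)
  have hpε : DualSpecializesAt V (D.p * D.z⁻¹) 0 :=
    (h.p_div_z_dual hp (hl.add hr).mem).congr rfl (by simp)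
  have hpbε := h.pb_dual hw hpb ((hl'.add hr').congr rfl (add_zero 0))
  have hwε : DualSpecializesAt V D.w (inr (-(j₀ * κ₀))) := by
    refine ⟨hw, ((h.j.mul h.κ).mul ((hl.sub hl').sub (hr.sub hr'))).congr ?_ (by simp)⟩
    rw [D.w_snd]; ring
  have hρ2 := h.isotropic_ratio_dual hιε hzbε
  have hρ3 := pow_three_dualSpecializesAt_zero hρ2
  have key := rigidityDefect_leading (t := 1) D.rigidity_deriv h.mul_inv_z hιε h.j.inl hzbε
    (hwε.congr (mul_one _).symm rfl) (hpε.congr (by simp) rfl)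
    (hpbε.congr (mul_one _).symm rfl) hρ3 ((hρ3.mul hρ2).congr (by ring) (mul_zero 0))
  have hsnd := congrArg snd key
  simp [h.j_ne_zero, h.κ_ne_zero] at hsnd

end Isotropic

section Infinite

theorem momentum_div_specializesAt_zero (h : D.EscapesAt V j₀ κ₀) (hzb : D.zb.fst ∉ V)
    (hA : D.AttractionVanishesAt V) (hw : D.w.fst ∈ V) :
    SpecializesAt V (D.p.fst * D.z.fst⁻¹) 0 ∧ SpecializesAt V (D.pb.fst * D.zb.fst⁻¹) 0 := by
  obtain ⟨hl, he⟩ := h.integrals_mem V.one_mem (by rwa [mul_one])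
    (by simpa only [one_pow, mul_one] using (hA.u.add hA.v).mem)
  obtain ⟨_, hl⟩ := SpecializesTo.exists_of_mem hl
  obtain ⟨_, he⟩ := SpecializesTo.exists_of_mem he
  have hz0 := h.z_ne_zero
  have hzb0 : D.zb.fst ≠ 0 := (h.conj hzb).z_ne_zero
  have hι := h.inv_z.mul (SpecializesTo.inv_of_notMem hzb)
  have hsub : SpecializesAt V (D.p.fst * D.z.fst⁻¹ - D.pb.fst * D.zb.fst⁻¹) 0 :=
    (hl.mul hι).congr (by field_simp) (by simp)
  have hp := specializesAt_zero_of_sub_of_mul hsub ((he.mul hι).congr (by field_simp) (by simp))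
  exact ⟨hp, (hp.sub hsub).congr (by ring) (sub_zero 0)⟩

theorem quotient_dual (h : D.EscapesAt V j₀ κ₀) (hzb : D.zb.fst ∉ V)
    (hw : SpecializesAt V D.w.fst w₀)
    (hp : SpecializesAt V (D.p.fst * D.z.fst⁻¹) 0) (hpb : SpecializesAt V (D.pb.fst * D.zb.fst⁻¹) 0)
    (hq : SpecializesAt V (D.z.fst * D.zb.fst⁻¹) y) :
    DualSpecializesAt V (D.z * D.zb⁻¹) (inl y + inr (-2 * (j₀ * w₀) * y)) := by
  have hz0 := h.z_ne_zero
  have hzb0 : D.zb.fst ≠ 0 := (h.conj hzb).z_ne_zero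
  refine ⟨hq.congr rfl (by simp),
    (hq.mul ((hp.sub hpb).sub ((SpecializesTo.ofNat 2).mul (h.j.mul hw)))).congr ?_ ?_⟩
  · simp only [snd_mul, snd_inv, MulOpposite.op_inv, D.z_snd, D.zb_snd, smul_eq_mul,
      MulOpposite.smul_eq_mul_unop, MulOpposite.unop_inv, MulOpposite.unop_op, fst_inv]
    field_simp
    ring
  · simp only [snd_add, snd_inl, snd_inr]
    ring

variable [CharZero (IsLocalRing.ResidueField V)]

theorem ratio_dual {X : DualNumber (IsLocalRing.ResidueField V)}
    (hX : RecedesAlong (dualGraph (placeGraph V)) D.z D.zb D.z⁻¹ D.zb⁻¹ X) :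
    DualSpecializesAt V D.ρ 1 ∨ DualSpecializesAt V D.ρ (-1) := by
  have hρ₂ := hX.ratio_sq D.ρ_sq
  obtain ⟨r, hr, hr₂⟩ := SpecializesTo.exists_of_pow two_ne_zero
    (hρ₂.1.congr (fst_pow D.ρ 2) rfl)
  have hr0 : r ≠ 0 := by
    rintro rfl
    simp at hr₂
  obtain ⟨R, hR, hR₂, -⟩ := hρ₂.dual_of_sq hr (isUnit_iff_ne_zero.2 (mul_ne_zero two_ne_zero hr0))
  rcases eq_one_or_eq_neg_one_of_sq_eq_one hR₂ with rfl | rfl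
  exacts [.inl hR, .inr hR]

theorem false_of_conj_infinite_of_le (h : D.EscapesAt V j₀ κ₀) (hzb : D.zb.fst ∉ V)
    (hle : D.z.fst * D.zb.fst⁻¹ ∈ V) : False := by
  have h' := h.conj hzb
  have hA := h.attractionVanishesAt h'.inv_z_add_one.mem h'.inv_z_sub_one.mem
  obtain ⟨w₀, hw, hw₀⟩ := h.exists_angular_velocity hA
  have hw1 : SpecializesAt V D.w.fst w₀ := hw.1
  have hc : j₀ * w₀ ≠ 0 := mul_ne_zero h.j_ne_zero hw₀
  obtain ⟨hμ, hμb⟩ := h.momentum_div_specializesAt_zero hzb hA hw1.mem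
  have hp : DualSpecializesAt V (D.p * D.z⁻¹) 0 :=
    (h.p_div_z_dual hμ (hA.left.add hA.right).mem).congr rfl (by simp)
  have hpb : DualSpecializesAt V (D.pb * D.zb⁻¹) 0 :=
    (h'.p_div_z_dual hμb (hA.left_conj.add hA.right_conj).mem).congr rfl (by simp)
  obtain ⟨x, hx⟩ := SpecializesTo.exists_of_mem hle
  have hX : RecedesAlong (dualGraph (placeGraph V)) D.z D.zb D.z⁻¹ D.zb⁻¹ _ :=
    ⟨h.mul_inv_z, h'.mul_inv_z, h.inv_z_dual hw1.mem hμ.mem, h'.inv_z_dual hw1.mem hμb.mem,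
      h.quotient_dual hzb hw1 hμ hμb hx⟩
  have hunit (n : DualNumber (IsLocalRing.ResidueField V)) (hn : IsUnit n) :
      IsUnit (n * (inl j₀ * inl w₀)) :=
    hn.mul (isUnit_iff_isUnit_fst.2 (isUnit_iff_ne_zero.2 (by simpa using hc)))
  have hX1 : (inl x + inr (-2 * (j₀ * w₀) * x)) ^ 2 = (1 : DualNumber _) := by
    rcases ratio_dual hX with hρ | hρ
    · have key := hX.rigidityDefect_leading_of_ratio_one D.rigidity_deriv D.ρ_sq hρ
        (isUnit_iff_isUnit_fst.2 (isUnit_iff_ne_zero.2 (by norm_num))) h.j.inl hw hp hpb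
      refine sub_eq_zero.1 ((hunit 24 ?_).mul_right_eq_zero.1 (by rwa [mul_assoc]))
      exact isUnit_iff_isUnit_fst.2 (isUnit_iff_ne_zero.2 (by simp))
    · have key := hX.rigidityDefect_leading_of_ratio_neg_one D.rigidity_deriv hρ h.j.inl hw hp hpb
      refine (congrArg (· ^ 2) (sub_eq_zero.1 ((hunit 12 ?_).mul_right_eq_zero.1
        (by rwa [mul_assoc])))).trans (one_pow 2)
      exact isUnit_iff_isUnit_fst.2 (isUnit_iff_ne_zero.2 (by simp))
  exact hc ((mul_eq_zero.1 (eq_zero_of_sq_eq_one hX1)).resolve_left (neg_ne_zero.2 two_ne_zero))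

end Infinite

end EscapesAt

theorem z_fst_mem [CharZero (IsLocalRing.ResidueField V)] (D : RigidPairJet K)
    {κ₀ : IsLocalRing.ResidueField V} (hκ : SpecializesAt V D.κ κ₀) (hκ₀ : κ₀ ≠ 0) (hL : D.L ∈ V)
    (hE : D.E ∈ V) : D.z.fst ∈ V := by
  by_contra hz
  obtain ⟨j₀, hj, -⟩ := SpecializesTo.exists_of_pow two_ne_zero
    (SpecializesTo.one.neg.congr D.j_sq.symm rfl)
  have h : D.EscapesAt V j₀ κ₀ := ⟨hj, hκ, hκ₀, hL, hE, hz⟩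
  by_cases hzb : D.zb.fst ∈ V
  · obtain ⟨y, hy⟩ := SpecializesTo.exists_of_mem hzb
    by_cases ha : y + 1 = 0
    · exact h.false_of_conj_eq_neg_one (eq_neg_of_add_eq_zero_left ha ▸ hy)
    by_cases hb : y - 1 = 0
    · rw [sub_eq_zero.1 hb] at hy
      exact h.swap.false_of_conj_eq_neg_one (hy.neg.congr rfl rfl)
    exact h.false_of_conj_finite hy ha hb
  · rcases V.mem_or_inv_mem (D.z.fst * D.zb.fst⁻¹) with hle | hle
    · exact h.false_of_conj_infinite_of_le hzb hle
    · rw [mul_inv, inv_inv, mul_comm] at hle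
      exact (h.conj hzb).false_of_conj_infinite_of_le hz hle

end RigidPairJet

end Places

section Germs

theorem mem_range_of_isIntegral_range {k K : Type*} [Field k] [IsAlgClosed k] [Field K]
    (c : k →+* K) {x : K} (hx : IsIntegral c.range x) : x ∈ c.range := by
  algebraize [c, c.rangeRestrict]
  have : IsScalarTower k c.range K := .of_algebraMap_eq fun _ => rfl
  have : Algebra.IsIntegral k c.range := Algebra.isIntegral_def.2 fun y => by
    obtain ⟨a, rfl⟩ := c.rangeRestrict_surjective y
    exact isIntegral_algebraMap
  exact minpoly.mem_range_of_degree_eq_one k x (IsAlgClosed.degree_eq_one_of_irreducible k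
    (minpoly.irreducible (isIntegral_trans x hx : IsIntegral k x)))

universe u v

variable {T : Type u} {k : Type v}

theorem exists_ultrafilter_germ_ne_const {z : T → k} (hz : (Set.range z).Infinite) :
    ∃ u : Ultrafilter T, ∀ c : k, (z : Filter.Germ (u : Filter T) k) ≠ fun _ : T => c := by
  have : (Filter.comap z Filter.cofinite).NeBot := Filter.comap_neBot_iff_frequently.2
    (Filter.frequently_cofinite_iff_infinite.2 hz)
  refine ⟨.of (Filter.comap z Filter.cofinite), fun c hc => ?_⟩
  have hne : ∀ᶠ t in Ultrafilter.of (Filter.comap z Filter.cofinite), z t ≠ c :=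
    Ultrafilter.of_le _ (Filter.preimage_mem_comap (Set.finite_singleton c).compl_mem_cofinite)
  obtain ⟨t, h, h'⟩ := (hne.and (Filter.Germ.coe_eq.1 hc)).exists
  exact h h'

theorem exists_place_of_infinite_range [Field k] [IsAlgClosed k] {z : T → k}
    (hz : (Set.range z).Infinite) : ∃ (K : Type max u v) (_ : Field K)
      (φ : (T → k) →+* K) (V : ValuationSubring K), (∀ c : k, φ (fun _ => c) ∈ V) ∧ φ z ∉ V := by
  obtain ⟨u, hu⟩ := exists_ultrafilter_germ_ne_const hz
  let φ : (T → k) →+* Filter.Germ (u : Filter T) k := Filter.Germ.coeRingHom (u : Filter T)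
  let c : k →+* Filter.Germ (u : Filter T) k := φ.comp (Pi.constRingHom T k)
  have hzc : φ z ∉ c.range := fun ⟨a, ha⟩ => hu a ha.symm
  have : IsIntegrallyClosedIn c.range (Filter.Germ (u : Filter T) k) :=
    Subring.isIntegrallyClosedIn_iff.2 fun x hx => mem_range_of_isIntegral_range c hx
  obtain ⟨V, hV, hzV⟩ := Subring.exists_le_valuationSubring_of_isIntegrallyClosedIn hzc
  exact ⟨_, inferInstance, φ, V, fun a => hV ⟨a, rfl⟩, hzV⟩

end Germs

section Functoriality

variable {A B : Type*} [CommRing A] [CommRing B] (φ : A →+* B)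

/-- Functoriality of dual numbers in the coefficient ring. -/
def mapDualNumber : DualNumber A →+* DualNumber B where
  toFun x := inl (φ x.fst) + inr (φ x.snd)
  map_one' := by ext <;> simp
  map_mul' x y := by ext <;> simp
  map_zero' := by ext <;> simp
  map_add' x y := by ext <;> simp

@[simp]
theorem fst_mapDualNumber (x : DualNumber A) : (mapDualNumber φ x).fst = φ x.fst := by
  simp [mapDualNumber]

@[simp]
theorem snd_mapDualNumber (x : DualNumber A) : (mapDualNumber φ x).snd = φ x.snd := by
  simp [mapDualNumber]

@[simp]
theorem mapDualNumber_inl (x : A) : mapDualNumber φ (inl x) = inl (φ x) := by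
  ext <;> simp

/-- The image of a jet under a homomorphism of the rings of values. -/
def RigidPairJet.map (D : RigidPairJet A) : RigidPairJet B where
  j := φ D.j
  κ := φ D.κ
  L := φ D.L
  E := φ D.E
  u := φ D.u
  v := φ D.v
  z := mapDualNumber φ D.z
  zb := mapDualNumber φ D.zb
  p := mapDualNumber φ D.p
  pb := mapDualNumber φ D.pb
  w := mapDualNumber φ D.w
  ρ := mapDualNumber φ D.ρ
  j_sq := by simpa using congrArg φ D.j_sq
  u_sq := by simpa using congrArg φ D.u_sq
  v_sq := by simpa using congrArg φ D.v_sq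
  ρ_sq := by simpa using congrArg (mapDualNumber φ) D.ρ_sq
  z_snd := by simpa using congrArg φ D.z_snd
  zb_snd := by simpa using congrArg φ D.zb_snd
  p_snd := by simpa [map_ofNat] using congrArg φ D.p_snd
  pb_snd := by simpa [map_ofNat] using congrArg φ D.pb_snd
  w_snd := by simpa using congrArg φ D.w_snd
  angular_momentum := by simpa [map_ofNat] using congrArg φ D.angular_momentum
  energy := by simpa [map_ofNat] using congrArg φ D.energy
  rigidity := by simpa using congrArg φ D.rigidity
  rigidity_deriv := by
    simpa [map_rigidityDefect] using congrArg (mapDualNumber φ) D.rigidity_deriv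

end Functoriality

section Finiteness

variable {T k : Type*} [Field k] [IsAlgClosed k] [CharZero k]

theorem RigidPairJet.finite_range_z (D : RigidPairJet (T → k)) {κ L E : k} (hκ : κ ≠ 0)
    (hDκ : D.κ = fun _ => κ) (hDL : D.L = fun _ => L) (hDE : D.E = fun _ => E) :
    (Set.range D.z.fst).Finite := by
  by_contra hinf
  obtain ⟨K, _, φ, V, hV, hzV⟩ := exists_place_of_infinite_range hinf
  let c : k →+* V := (φ.comp (Pi.constRingHom T k)).codRestrict V.toSubring hV
  let c' : k →+* IsLocalRing.ResidueField V := (IsLocalRing.residue V).comp c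
  have : CharZero (IsLocalRing.ResidueField V) := charZero_of_injective_ringHom c'.injective
  have hDV := (D.map φ).z_fst_mem (V := V) (κ₀ := c' κ)
    ((specializesAt_residue (c κ)).congr (congrArg φ hDκ.symm) rfl) ((map_ne_zero c').2 hκ)
    (by simpa only [map, hDL] using hV L) (by simpa only [map, hDE] using hV E)
  exact hzV (by simpa only [map, fst_mapDualNumber] using hDV)

end Finiteness

section FunctionJets

/-- The subring of functions which are differentiable at all points of `I`. -/
def differentiableSubring (I : Set ℝ) : Subring (ℝ → ℂ) where
  carrier := {f | ∀ t ∈ I, DifferentiableAt ℝ f t}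
  mul_mem' hf hg t ht := (hf t ht).mul (hg t ht)
  one_mem' _ _ := differentiableAt_const 1
  add_mem' hf hg t ht := (hf t ht).add (hg t ht)
  zero_mem' _ _ := differentiableAt_const 0
  neg_mem' hf t ht := (hf t ht).neg

/-- The first order jet along `I` of a function: its values and those of its derivative. -/
noncomputable def jetHom (I : Set ℝ) : differentiableSubring I →+* DualNumber (I → ℂ) where
  toFun f := inl (fun t : I => f.1 t) + inr (fun t : I => deriv f.1 t)
  map_one' := by
    ext t
    · simp
    · simp [Pi.one_def]
  map_mul' f g := by
    ext t
    · simp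
    · simp [deriv_mul (f.2 t t.2) (g.2 t t.2), add_comm, mul_comm]
  map_zero' := by
    ext t
    · simp
    · simp [Pi.zero_def]
  map_add' f g := by
    ext t
    · simp
    · simp [deriv_add (f.2 t t.2) (g.2 t t.2)]

@[simp]
theorem fst_jetHom {I : Set ℝ} (f : differentiableSubring I) (t : I) :
    (jetHom I f).fst t = f.1 t := by
  simp [jetHom]

@[simp]
theorem snd_jetHom {I : Set ℝ} (f : differentiableSubring I) (t : I) :
    (jetHom I f).snd t = deriv f.1 t := by
  simp [jetHom]

theorem jetHom_congr {I : Set ℝ} (hI : IsOpen I) {f g : differentiableSubring I}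
    (h : Set.EqOn f.1 g.1 I) : jetHom I f = jetHom I g := by
  ext t
  · simpa using h t.2
  · simpa using (h.eventuallyEq_of_mem (hI.mem_nhds t.2)).deriv_eq

end FunctionJets

section Motion

open ComplexConjugate

theorem hasDerivAt_inv_norm {a : ℝ → ℂ} {a' : ℂ} {t : ℝ} (h : HasDerivAt a a' t) (ha : a t ≠ 0) :
    HasDerivAt (fun t => (‖a t‖ : ℂ)⁻¹)
      (-((‖a t‖ : ℂ)⁻¹ ^ 3 * (a' * conj (a t) + conj a' * a t)) / 2) t := by
  have hn : HasDerivAt (fun t => ‖a t‖) (2 * inner ℝ (a t) a' / (2 * ‖a t‖)) t := by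
    simpa only [Real.sqrt_sq (norm_nonneg _)] using h.norm_sq.sqrt (by simpa using ha)
  have hinner : (inner ℝ (a t) a' : ℂ) = (a' * conj (a t) + conj a' * a t) / 2 := by
    rw [Complex.inner, Complex.re_eq_add_conj, map_mul, Complex.conj_conj, mul_comm (conj a'),
      mul_comm a']
  have hne : (‖a t‖ : ℂ) ≠ 0 := by simpa using ha
  refine (hn.ofReal_comp.fun_inv hne).congr_deriv ?_
  push_cast [hinner]
  field_simp

theorem inv_norm_sq_mul {a : ℂ} (ha : a ≠ 0) : (‖a‖ : ℂ)⁻¹ ^ 2 * (a * conj a) = 1 := by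
  rw [Complex.mul_conj', ← mul_pow, inv_mul_cancel₀ (by simpa using ha), one_pow]

theorem exists_eq_of_hasDerivAt_zero {E : Type*} [NormedAddCommGroup E] [NormedSpace ℝ E]
    {I : Set ℝ} (hIo : IsOpen I) (hIc : IsPreconnected I) {f : ℝ → E}
    (h : ∀ t ∈ I, HasDerivAt f 0 t) : ∃ c, ∀ t ∈ I, f t = c :=
  hIo.exists_is_const_of_deriv_eq_zero hIc
    (fun t ht => (h t ht).differentiableAt.differentiableWithinAt) fun t ht => (h t ht).deriv

theorem hasDerivAt_unique_of_eqOn {I : Set ℝ} (hI : IsOpen I) {t : ℝ} (ht : t ∈ I) {f g : ℝ → ℂ}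
    {f' g' : ℂ} (hf : HasDerivAt f f' t) (hg : HasDerivAt g g' t) (h : Set.EqOn f g I) :
    f' = g' :=
  hf.unique (hg.congr_of_eventuallyEq (h.eventuallyEq_of_mem (hI.mem_nhds ht)))

theorem rigidityDefect_mul_eq_zero {A : Type*} [CommRing A] {j w z zb p pb r u v : A}
    (hr : r ^ 2 = (z + 1) * (zb + 1)) (hu : r * u = 1)
    (h : 4 * j * w * (u ^ 3 - v ^ 3) * (z - zb) =
      -3 * u ^ 5 * (p * (zb + 1) + pb * (z + 1) - j * w * (z - zb)) * ((z + 1) + (zb + 1))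
      + 3 * v ^ 5 * (p * (zb - 1) + pb * (z - 1) + j * w * (z - zb)) * ((z - 1) + (zb - 1))
      + 2 * (u ^ 3 - v ^ 3) * (p + pb - j * w * (z - zb))) :
    rigidityDefect j w z zb p pb (r * v) = 0 := by
  have hu3 : u ^ 3 * r ^ 5 = (z + 1) * (zb + 1) := by
    rw [← hr]
    linear_combination r ^ 2 * ((r * u) ^ 2 + r * u + 1) * hu
  have hu5 : u ^ 5 * r ^ 5 = 1 := by rw [← mul_pow, mul_comm, hu, one_pow]
  have hv3 : v ^ 3 * r ^ 5 = (r * v) ^ 3 * ((z + 1) * (zb + 1)) := by rw [← hr]; ring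
  rw [rigidityDefect]
  linear_combination r ^ 5 * h
    - (6 * j * w * (z - zb) - 2 * (p + pb)) * (hu3 - hv3)
    - 3 * (p * (zb + 1) + pb * (z + 1) - j * w * (z - zb)) * ((z + 1) + (zb + 1)) * hu5

/-- The motion of three equal masses two of which keep their distance, in the frame in which these
two rest at `1` and `-1`: `z` is the position and `p` the inertial velocity of the third body, and
`w` is the angular velocity of the frame. Since time derivatives are derivatives in the frame, the
rotation contributes the terms with `Complex.I * w t`. -/
structure IsRigidPairMotion (I : Set ℝ) (κ : ℝ) (z p : ℝ → ℂ) (w : ℝ → ℝ) : Prop where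
  add_one_ne : ∀ t ∈ I, z t + 1 ≠ 0
  sub_one_ne : ∀ t ∈ I, z t - 1 ≠ 0
  hasDerivAt_z : ∀ t ∈ I, HasDerivAt z (p t - Complex.I * w t * z t) t
  hasDerivAt_p : ∀ t ∈ I, HasDerivAt p (-(Complex.I * w t * p t) - 6 * κ *
    ((‖z t + 1‖ : ℂ)⁻¹ ^ 3 * (z t + 1) + (‖z t - 1‖ : ℂ)⁻¹ ^ 3 * (z t - 1))) t
  hasDerivAt_w : ∀ t ∈ I, HasDerivAt (fun t => (w t : ℂ)) (Complex.I * κ *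
    (((‖z t + 1‖ : ℂ)⁻¹ ^ 3 - (‖z t - 1‖ : ℂ)⁻¹ ^ 3) * (z t - conj (z t)))) t
  rigidity : ∀ t ∈ I, (w t : ℂ) ^ 2 = κ * (1 +
    ((‖z t + 1‖ : ℂ)⁻¹ ^ 3 * (z t + 1) + (‖z t + 1‖ : ℂ)⁻¹ ^ 3 * (conj (z t) + 1))
    - ((‖z t - 1‖ : ℂ)⁻¹ ^ 3 * (z t - 1) + (‖z t - 1‖ : ℂ)⁻¹ ^ 3 * (conj (z t) - 1)))

namespace IsRigidPairMotion

variable {I : Set ℝ} {κ : ℝ} {z p : ℝ → ℂ} {w : ℝ → ℝ}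

theorem norm_add_one_ne (h : IsRigidPairMotion I κ z p w) {t : ℝ} (ht : t ∈ I) :
    (‖z t + 1‖ : ℂ) ≠ 0 := by
  simpa using h.add_one_ne t ht

theorem norm_ratio_sq (h : IsRigidPairMotion I κ z p w) {t : ℝ} (ht : t ∈ I) :
    (‖z t + 1‖ * (‖z t - 1‖ : ℂ)⁻¹) ^ 2 * ((z t - 1) * (conj (z t) - 1)) =
      (z t + 1) * (conj (z t) + 1) := by
  have hs := inv_norm_sq_mul (h.sub_one_ne t ht)
  have hr := Complex.mul_conj' (z t + 1)
  simp only [map_add, map_sub, map_one] at hr hs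
  linear_combination (‖z t + 1‖ : ℂ) ^ 2 * hs - hr

theorem hasDerivAt_conj_z (h : IsRigidPairMotion I κ z p w) {t : ℝ} (ht : t ∈ I) :
    HasDerivAt (fun t => conj (z t)) (conj (p t) + Complex.I * w t * conj (z t)) t :=
  (h.hasDerivAt_z t ht).star.congr_deriv (by simp)

theorem hasDerivAt_conj_p (h : IsRigidPairMotion I κ z p w) {t : ℝ} (ht : t ∈ I) :
    HasDerivAt (fun t => conj (p t)) (Complex.I * w t * conj (p t) - 6 * κ *
      ((‖z t + 1‖ : ℂ)⁻¹ ^ 3 * (conj (z t) + 1) + (‖z t - 1‖ : ℂ)⁻¹ ^ 3 * (conj (z t) - 1))) t :=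
  (h.hasDerivAt_p t ht).star.congr_deriv (by simp)

theorem hasDerivAt_inv_norm_add_one (h : IsRigidPairMotion I κ z p w) {t : ℝ} (ht : t ∈ I) :
    HasDerivAt (fun t => (‖z t + 1‖ : ℂ)⁻¹) (-((‖z t + 1‖ : ℂ)⁻¹ ^ 3 *
      (p t * (conj (z t) + 1) + conj (p t) * (z t + 1)
      - Complex.I * w t * (z t - conj (z t)))) / 2) t := by
  refine (hasDerivAt_inv_norm ((h.hasDerivAt_z t ht).add_const 1)
    (h.add_one_ne t ht)).congr_deriv ?_
  simp only [map_add, map_sub, map_mul, map_one, Complex.conj_I, Complex.conj_ofReal]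
  ring

theorem hasDerivAt_inv_norm_sub_one (h : IsRigidPairMotion I κ z p w) {t : ℝ} (ht : t ∈ I) :
    HasDerivAt (fun t => (‖z t - 1‖ : ℂ)⁻¹) (-((‖z t - 1‖ : ℂ)⁻¹ ^ 3 *
      (p t * (conj (z t) - 1) + conj (p t) * (z t - 1)
      + Complex.I * w t * (z t - conj (z t)))) / 2) t := by
  refine (hasDerivAt_inv_norm ((h.hasDerivAt_z t ht).sub_const 1)
    (h.sub_one_ne t ht)).congr_deriv ?_
  simp only [map_sub, map_mul, map_one, Complex.conj_I, Complex.conj_ofReal]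
  ring

theorem differentiableAt_norm_ratio (h : IsRigidPairMotion I κ z p w) {t : ℝ} (ht : t ∈ I) :
    DifferentiableAt ℝ (fun t => ‖z t + 1‖ * (‖z t - 1‖ : ℂ)⁻¹) t := by
  have := (h.hasDerivAt_inv_norm_add_one ht).differentiableAt.fun_inv
    (inv_ne_zero (h.norm_add_one_ne ht))
  simp only [inv_inv] at this
  exact this.fun_mul (h.hasDerivAt_inv_norm_sub_one ht).differentiableAt

theorem exists_angular_momentum_eq (h : IsRigidPairMotion I κ z p w) (hIo : IsOpen I)
    (hIc : IsPreconnected I) : ∃ L : ℂ, ∀ t ∈ I,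
      conj (z t) * p t - z t * conj (p t) + 6 * Complex.I * w t = L := by
  refine exists_eq_of_hasDerivAt_zero hIo hIc fun t ht => ?_
  refine ((((h.hasDerivAt_conj_z ht).fun_mul (h.hasDerivAt_p t ht)).fun_sub
    ((h.hasDerivAt_z t ht).fun_mul (h.hasDerivAt_conj_p ht))).fun_add
    ((h.hasDerivAt_w t ht).const_mul (6 * Complex.I))).congr_deriv ?_
  linear_combination (6 * κ * (((‖z t + 1‖ : ℂ)⁻¹ ^ 3 - (‖z t - 1‖ : ℂ)⁻¹ ^ 3) *
    (z t - conj (z t)))) * Complex.I_sq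

theorem exists_energy_eq (h : IsRigidPairMotion I κ z p w) (hIo : IsOpen I)
    (hIc : IsPreconnected I) : ∃ E : ℂ, ∀ t ∈ I,
      p t * conj (p t) - 12 * κ * ((‖z t + 1‖ : ℂ)⁻¹ + (‖z t - 1‖ : ℂ)⁻¹) + 3 * (w t : ℂ) ^ 2
        = E := by
  refine exists_eq_of_hasDerivAt_zero hIo hIc fun t ht => ?_
  refine ((((h.hasDerivAt_p t ht).fun_mul (h.hasDerivAt_conj_p ht)).fun_sub
    (((h.hasDerivAt_inv_norm_add_one ht).fun_add (h.hasDerivAt_inv_norm_sub_one ht)).const_mul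
      (12 * κ : ℂ))).fun_add
    (((h.hasDerivAt_w t ht).fun_pow 2).const_mul (3 : ℂ))).congr_deriv ?_
  push_cast
  ring

theorem deriv_rigidity (h : IsRigidPairMotion I κ z p w) (hκ : κ ≠ 0) (hIo : IsOpen I) {t : ℝ}
    (ht : t ∈ I) :
    4 * Complex.I * w t * ((‖z t + 1‖ : ℂ)⁻¹ ^ 3 - (‖z t - 1‖ : ℂ)⁻¹ ^ 3) * (z t - conj (z t)) =
      -3 * (‖z t + 1‖ : ℂ)⁻¹ ^ 5 * (p t * (conj (z t) + 1) + conj (p t) * (z t + 1)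
        - Complex.I * w t * (z t - conj (z t))) * ((z t + 1) + (conj (z t) + 1))
      + 3 * (‖z t - 1‖ : ℂ)⁻¹ ^ 5 * (p t * (conj (z t) - 1) + conj (p t) * (z t - 1)
        + Complex.I * w t * (z t - conj (z t))) * ((z t - 1) + (conj (z t) - 1))
      + 2 * ((‖z t + 1‖ : ℂ)⁻¹ ^ 3 - (‖z t - 1‖ : ℂ)⁻¹ ^ 3)
        * (p t + conj (p t) - Complex.I * w t * (z t - conj (z t))) := by
  have hz := h.hasDerivAt_z t ht
  have hzb := h.hasDerivAt_conj_z ht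
  have hu := (h.hasDerivAt_inv_norm_add_one ht).fun_pow 3
  have hv := (h.hasDerivAt_inv_norm_sub_one ht).fun_pow 3
  have key := hasDerivAt_unique_of_eqOn hIo ht ((h.hasDerivAt_w t ht).fun_pow 2)
    (((((hu.fun_mul (hz.add_const 1)).fun_add (hu.fun_mul (hzb.add_const 1))).const_add
      1).fun_sub ((hv.fun_mul (hz.sub_const 1)).fun_add
      (hv.fun_mul (hzb.sub_const 1)))).const_mul (κ : ℂ)) h.rigidity
  refine mul_left_cancel₀ (Complex.ofReal_ne_zero.2 hκ) ?_
  push_cast at key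
  linear_combination 2 * key

theorem rigidityDefect_eq_zero (h : IsRigidPairMotion I κ z p w) (hκ : κ ≠ 0) (hIo : IsOpen I)
    {t : ℝ} (ht : t ∈ I) :
    rigidityDefect Complex.I (w t) (z t) (conj (z t)) (p t) (conj (p t))
      (‖z t + 1‖ * (‖z t - 1‖ : ℂ)⁻¹) = 0 :=
  rigidityDefect_mul_eq_zero (by rw [← Complex.mul_conj', map_add, map_one])
    (mul_inv_cancel₀ (h.norm_add_one_ne ht)) (h.deriv_rigidity hκ hIo ht)

theorem exists_jet (h : IsRigidPairMotion I κ z p w) (hκ : κ ≠ 0) (hIo : IsOpen I) {L E : ℂ}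
    (hL : ∀ t ∈ I, conj (z t) * p t - z t * conj (p t) + 6 * Complex.I * w t = L)
    (hE : ∀ t ∈ I, p t * conj (p t) - 12 * κ * ((‖z t + 1‖ : ℂ)⁻¹ + (‖z t - 1‖ : ℂ)⁻¹)
      + 3 * (w t : ℂ) ^ 2 = E) :
    ∃ D : RigidPairJet (I → ℂ), (D.z.fst = fun t : I => z t) ∧ (D.κ = fun _ => (κ : ℂ)) ∧
      (D.L = fun _ => L) ∧ (D.E = fun _ => E) := by
  let J : differentiableSubring I := ⟨fun _ => Complex.I, fun _ _ => differentiableAt_const _⟩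
  let Z : differentiableSubring I := ⟨z, fun t ht => (h.hasDerivAt_z t ht).differentiableAt⟩
  let Zb : differentiableSubring I :=
    ⟨fun t => conj (z t), fun _ ht => (h.hasDerivAt_conj_z ht).differentiableAt⟩
  let P : differentiableSubring I := ⟨p, fun t ht => (h.hasDerivAt_p t ht).differentiableAt⟩
  let Pb : differentiableSubring I :=
    ⟨fun t => conj (p t), fun _ ht => (h.hasDerivAt_conj_p ht).differentiableAt⟩
  let W : differentiableSubring I :=
    ⟨fun t => (w t : ℂ), fun t ht => (h.hasDerivAt_w t ht).differentiableAt⟩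
  let R : differentiableSubring I :=
    ⟨fun t => ‖z t + 1‖ * (‖z t - 1‖ : ℂ)⁻¹, fun _ ht => h.differentiableAt_norm_ratio ht⟩
  have hJ : inl (fun _ => Complex.I) = jetHom I J := by ext t <;> simp [J]
  refine ⟨{ j := fun _ => Complex.I, κ := fun _ => κ, L := fun _ => L, E := fun _ => E
            u := fun t => (‖z t + 1‖ : ℂ)⁻¹, v := fun t => (‖z t - 1‖ : ℂ)⁻¹
            z := jetHom I Z, zb := jetHom I Zb, p := jetHom I P, pb := jetHom I Pb
            w := jetHom I W, ρ := jetHom I R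
            j_sq := by ext t; simp
            u_sq := by ext t; simpa using inv_norm_sq_mul (h.add_one_ne t t.2)
            v_sq := by ext t; simpa using inv_norm_sq_mul (h.sub_one_ne t t.2)
            ρ_sq := ?_
            z_snd := by ext t; simpa using (h.hasDerivAt_z t t.2).deriv
            zb_snd := by ext t; simpa using (h.hasDerivAt_conj_z t.2).deriv
            p_snd := by ext t; simpa using (h.hasDerivAt_p t t.2).deriv
            pb_snd := by ext t; simpa using (h.hasDerivAt_conj_p t.2).deriv
            w_snd := by ext t; simpa using (h.hasDerivAt_w t t.2).deriv
            angular_momentum := by ext t; simpa using hL t t.2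
            energy := by ext t; simpa using hE t t.2
            rigidity := by ext t; simpa using h.rigidity t t.2
            rigidity_deriv := ?_ }, by ext t; simp [Z], rfl, rfl, rfl⟩
  · simp only [← map_one (jetHom I), ← map_add, ← map_sub, ← map_mul, ← map_pow]
    exact jetHom_congr hIo fun _ => h.norm_ratio_sq
  · rw [hJ, ← map_rigidityDefect, ← map_zero (jetHom I)]
    refine jetHom_congr hIo fun t ht => ?_
    let eval := (Pi.evalRingHom (fun _ : ℝ => ℂ) t).comp (differentiableSubring I).subtype
    exact (map_rigidityDefect eval J W Z Zb P Pb R).trans (h.rigidityDefect_eq_zero hκ hIo ht)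

theorem exists_z_eq (h : IsRigidPairMotion I κ z p w) (hκ : κ ≠ 0) (hIo : IsOpen I)
    (hIc : IsPreconnected I) : ∃ c, ∀ t ∈ I, z t = c := by
  obtain ⟨L, hL⟩ := h.exists_angular_momentum_eq hIo hIc
  obtain ⟨E, hE⟩ := h.exists_energy_eq hIo hIc
  obtain ⟨D, hDz, hDκ, hDL, hDE⟩ := h.exists_jet hκ hIo hL hE
  have hfin := D.finite_range_z (Complex.ofReal_ne_zero.2 hκ) hDκ hDL hDE
  have hconn : IsPreconnected (z '' I) :=
    hIc.image z fun t ht => (h.hasDerivAt_z t ht).continuousAt.continuousWithinAt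
  rw [hDz, ← Set.image_eq_range] at hfin
  have hss : (z '' I).Subsingleton :=
    Set.not_nontrivial_iff.1 fun hn => hconn.infinite_of_nontrivial hn hfin
  rcases I.eq_empty_or_nonempty with rfl | ⟨t₀, ht₀⟩
  · exact ⟨0, by simp⟩
  · exact ⟨z t₀, fun t ht => hss (Set.mem_image_of_mem z ht) (Set.mem_image_of_mem z ht₀)⟩

end IsRigidPairMotion

end Motion

end Jets

section Rest

open ComplexConjugate

theorem eq_of_collinear_rest {x : ℝ} (hx₁ : x + 1 ≠ 0) (hx₂ : x - 1 ≠ 0)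
    (h : (1 + (|x + 1|⁻¹ ^ 3 * (x + 1) + |x + 1|⁻¹ ^ 3 * (x + 1))
        - (|x - 1|⁻¹ ^ 3 * (x - 1) + |x - 1|⁻¹ ^ 3 * (x - 1))) * x =
      6 * (|x + 1|⁻¹ ^ 3 * (x + 1) + |x - 1|⁻¹ ^ 3 * (x - 1))) : x = 0 ∨ x = 3 ∨ x = -3 := by
  wlog hx : 0 ≤ x generalizing x
  · have habs : |-x + 1| = |x - 1| ∧ |-x - 1| = |x + 1| :=
      ⟨by rw [← abs_neg]; ring_nf, by rw [← abs_neg]; ring_nf⟩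
    have := @this (-x) (by contrapose! hx₂; linarith) (by contrapose! hx₁; linarith)
      (by rw [habs.1, habs.2]; linear_combination -h) (by linarith)
    grind
  rw [abs_of_pos (by linarith : 0 < x + 1)] at h
  rcases lt_or_gt_of_ne hx₂ with hx' | hx'
  · rw [abs_of_neg hx'] at h
    field_simp at h
    have hfactor :
        x * ((x + 1) ^ 2 * (x - 1) ^ 2 + 2 * (x - 1) ^ 2 + 2 * (x + 1) ^ 2 + 24) = 0 := by
      linear_combination h
    exact .inl ((mul_eq_zero.1 hfactor).resolve_right (by positivity))
  · rw [abs_of_pos hx'] at h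
    field_simp at h
    have hfactor : (x - 3) * (x ^ 4 + 3 * x ^ 3 + 7 * x ^ 2 + x + 4) = 0 := by
      linear_combination h
    exact .inr (.inl (sub_eq_zero.1 ((mul_eq_zero.1 hfactor).resolve_right (by positivity))))

/-- The third body rests at `c` relative to the bodies of the rigid pair at `1` and `-1`: the
attraction balances the centrifugal force of the rotation that keeps the pair rigid. -/
def IsRestPosition (c : ℂ) : Prop :=
  (1 + ((‖c + 1‖ : ℂ)⁻¹ ^ 3 * (c + 1) + (‖c + 1‖ : ℂ)⁻¹ ^ 3 * (conj c + 1))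
      - ((‖c - 1‖ : ℂ)⁻¹ ^ 3 * (c - 1) + (‖c - 1‖ : ℂ)⁻¹ ^ 3 * (conj c - 1))) * c =
    6 * ((‖c + 1‖ : ℂ)⁻¹ ^ 3 * (c + 1) + (‖c - 1‖ : ℂ)⁻¹ ^ 3 * (c - 1))

/-- The third body of one of Euler's collinear relative equilibria of three equal masses, the other
two being at `1` and `-1`. -/
def IsEulerPoint (c : ℂ) : Prop :=
  c = 0 ∨ c = 3 ∨ c = -3

/-- The third body of one of Lagrange's equilateral relative equilibria, the other two being at `1`
and `-1`. -/
def IsLagrangePoint (c : ℂ) : Prop :=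
  ‖c + 1‖ = 2 ∧ ‖c - 1‖ = 2

theorem isLagrangePoint_of_norm_eq {c : ℂ} (hc : c ≠ 0) (hnorm : ‖c + 1‖ = ‖c - 1‖)
    (h : IsRestPosition c) : IsLagrangePoint c := by
  rw [IsRestPosition, ← hnorm] at h
  rw [IsLagrangePoint, ← hnorm]
  have hcube : (1 : ℂ) = 8 * (‖c + 1‖ : ℂ)⁻¹ ^ 3 :=
    mul_right_cancel₀ hc (by linear_combination h)
  have hcube' : (2 : ℝ)⁻¹ ^ 3 = ‖c + 1‖⁻¹ ^ 3 := by
    have : (1 : ℝ) = 8 * ‖c + 1‖⁻¹ ^ 3 := by exact_mod_cast hcube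
    linarith
  have := inv_injective ((pow_left_inj₀ (by positivity) (by positivity) three_ne_zero).1 hcube')
  exact ⟨this.symm, this.symm⟩

theorem isEulerPoint_or_isLagrangePoint {c : ℂ} (hc₁ : c + 1 ≠ 0) (hc₂ : c - 1 ≠ 0)
    (hw : ((‖c + 1‖ : ℂ)⁻¹ ^ 3 - (‖c - 1‖ : ℂ)⁻¹ ^ 3) * (c - conj c) = 0)
    (h : IsRestPosition c) :
    IsEulerPoint c ∨ IsLagrangePoint c := by
  by_cases hreal : conj c = c
  · obtain ⟨x, rfl⟩ := Complex.conj_eq_iff_real.1 hreal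
    rw [IsRestPosition, Complex.conj_ofReal] at h
    have hx := eq_of_collinear_rest (x := x) (by exact_mod_cast hc₁) (by exact_mod_cast hc₂)
      (by simp only [← Real.norm_eq_abs]; exact_mod_cast h)
    exact .inl (by unfold IsEulerPoint; exact_mod_cast hx)
  · have hcube : (‖c + 1‖ : ℂ)⁻¹ ^ 3 = (‖c - 1‖ : ℂ)⁻¹ ^ 3 :=
      sub_eq_zero.1 ((mul_eq_zero.1 hw).resolve_right (sub_ne_zero.2 (Ne.symm hreal)))
    have hcube' : ‖c + 1‖⁻¹ ^ 3 = ‖c - 1‖⁻¹ ^ 3 := by exact_mod_cast hcube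
    have hnorm := inv_injective ((pow_left_inj₀ (by positivity) (by positivity)
      three_ne_zero).1 hcube')
    exact .inr (isLagrangePoint_of_norm_eq (fun h0 => hreal (by rw [h0, map_zero])) hnorm h)

namespace IsRigidPairMotion

variable {I : Set ℝ} {κ : ℝ} {z p : ℝ → ℂ} {w : ℝ → ℝ} {c : ℂ}

theorem angular_acceleration_eq_zero (h : IsRigidPairMotion I κ z p w) (hIo : IsOpen I)
    (hz : ∀ t ∈ I, z t = c) {t₀ : ℝ} (ht₀ : t₀ ∈ I) :
    Complex.I * κ * (((‖c + 1‖ : ℂ)⁻¹ ^ 3 - (‖c - 1‖ : ℂ)⁻¹ ^ 3) * (c - conj c)) = 0 := by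
  set g := Complex.I * κ * (((‖c + 1‖ : ℂ)⁻¹ ^ 3 - (‖c - 1‖ : ℂ)⁻¹ ^ 3) * (c - conj c))
  have hw : ∀ t ∈ I, HasDerivAt (fun t => (w t : ℂ)) g t := fun t ht => by
    simpa only [hz t ht] using h.hasDerivAt_w t ht
  have hsq : ∀ t ∈ I, (w t : ℂ) ^ 2 = (w t₀ : ℂ) ^ 2 := fun t ht => by
    rw [h.rigidity t ht, h.rigidity t₀ ht₀, hz t ht, hz t₀ ht₀]
  by_contra hg
  have hw₀ : ∀ t ∈ I, (w t : ℂ) = 0 := fun t ht => by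
    simpa [hg] using
      hasDerivAt_unique_of_eqOn hIo ht ((hw t ht).fun_pow 2) (hasDerivAt_const t _) hsq
  exact hg (hasDerivAt_unique_of_eqOn hIo ht₀ (hw t₀ ht₀) (hasDerivAt_const t₀ _) hw₀)

theorem exists_w_eq (h : IsRigidPairMotion I κ z p w) (hIo : IsOpen I) (hIc : IsPreconnected I)
    (hz : ∀ t ∈ I, z t = c) : ∃ ω : ℝ, ∀ t ∈ I, w t = ω := by
  obtain ⟨W, hW⟩ := exists_eq_of_hasDerivAt_zero hIo hIc fun t ht =>
    (h.hasDerivAt_w t ht).congr_deriv (by rw [hz t ht, h.angular_acceleration_eq_zero hIo hz ht])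
  exact ⟨W.re, fun t ht => by rw [← hW t ht, Complex.ofReal_re]⟩

theorem isRestPosition (h : IsRigidPairMotion I κ z p w) (hκ : κ ≠ 0) (hIo : IsOpen I)
    (hz : ∀ t ∈ I, z t = c) {ω : ℝ} (hw : ∀ t ∈ I, w t = ω) {t₀ : ℝ} (ht₀ : t₀ ∈ I) :
    IsRestPosition c := by
  have hp : ∀ t ∈ I, p t = Complex.I * ω * c := fun t ht => by
    have := hasDerivAt_unique_of_eqOn hIo ht (h.hasDerivAt_z t ht) (hasDerivAt_const t c) hz
    rw [hz t ht, hw t ht] at this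
    exact sub_eq_zero.1 this
  have hp' := hasDerivAt_unique_of_eqOn hIo ht₀ (h.hasDerivAt_p t₀ ht₀) (hasDerivAt_const t₀ _) hp
  have hrig := h.rigidity t₀ ht₀
  rw [hz t₀ ht₀, hw t₀ ht₀] at hrig
  rw [hp t₀ ht₀, hz t₀ ht₀, hw t₀ ht₀] at hp'
  refine mul_left_cancel₀ (Complex.ofReal_ne_zero.2 hκ) ?_
  linear_combination hp' - c * hrig + (ω : ℂ) ^ 2 * c * Complex.I_sq

theorem exists_rest (h : IsRigidPairMotion I κ z p w) (hκ : κ ≠ 0) (hIo : IsOpen I)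
    (hIc : IsPreconnected I) (hne : I.Nonempty) :
    ∃ (c : ℂ) (ω : ℝ), (∀ t ∈ I, z t = c ∧ w t = ω) ∧
      (IsEulerPoint c ∨ IsLagrangePoint c) := by
  obtain ⟨c, hz⟩ := h.exists_z_eq hκ hIo hIc
  obtain ⟨ω, hw⟩ := h.exists_w_eq hIo hIc hz
  obtain ⟨t₀, ht₀⟩ := hne
  refine ⟨c, ω, fun t ht => ⟨hz t ht, hw t ht⟩, isEulerPoint_or_isLagrangePoint ?_ ?_ ?_
    (h.isRestPosition hκ hIo hz hw ht₀)⟩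
  · exact hz t₀ ht₀ ▸ h.add_one_ne t₀ ht₀
  · exact hz t₀ ht₀ ▸ h.sub_one_ne t₀ ht₀
  · exact (mul_eq_zero.1 (h.angular_acceleration_eq_zero hIo hz ht₀)).resolve_left
      (mul_ne_zero Complex.I_ne_zero (Complex.ofReal_ne_zero.2 hκ))

end IsRigidPairMotion

end Rest

section Jacobi

open ComplexConjugate

/-- Three bodies of equal masses two of which keep their distance, in Jacobi coordinates and with
half that distance as unit of length: `X` is the direction of the rigid pair, `y` the position of
the third body relative to the midpoint of the pair, and `X'`, `y'` are their time derivatives. -/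
structure IsJacobiMotion (I : Set ℝ) (κ : ℝ) (X X' y y' : ℝ → ℂ) : Prop where
  norm_X : ∀ t ∈ I, ‖X t‖ = 1
  add_ne : ∀ t ∈ I, y t + X t ≠ 0
  sub_ne : ∀ t ∈ I, y t - X t ≠ 0
  hasDerivAt_X : ∀ t ∈ I, HasDerivAt X (X' t) t
  hasDerivAt_y : ∀ t ∈ I, HasDerivAt y (y' t) t
  hasDerivAt_X' : ∀ t ∈ I, HasDerivAt X' (-κ * (X t + 2 * ((‖y t + X t‖ : ℂ)⁻¹ ^ 3 * (y t + X t))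
    - 2 * ((‖y t - X t‖ : ℂ)⁻¹ ^ 3 * (y t - X t)))) t
  hasDerivAt_y' : ∀ t ∈ I, HasDerivAt y' (-6 * κ * ((‖y t + X t‖ : ℂ)⁻¹ ^ 3 * (y t + X t)
    + (‖y t - X t‖ : ℂ)⁻¹ ^ 3 * (y t - X t))) t

/-- The angular velocity of a unit vector `X` with time derivative `X'`. -/
noncomputable def angularVelocity (X X' : ℝ → ℂ) (t : ℝ) : ℝ :=
  (-Complex.I * X' t * conj (X t)).re

namespace IsJacobiMotion

variable {I : Set ℝ} {κ : ℝ} {X X' y y' : ℝ → ℂ}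

theorem mul_conj_X (h : IsJacobiMotion I κ X X' y y') {t : ℝ} (ht : t ∈ I) :
    X t * conj (X t) = 1 := by
  rw [Complex.mul_conj', h.norm_X t ht, Complex.ofReal_one, one_pow]

theorem ofReal_angularVelocity (h : IsJacobiMotion I κ X X' y y') (hIo : IsOpen I) {t : ℝ}
    (ht : t ∈ I) : (angularVelocity X X' t : ℂ) = -Complex.I * X' t * conj (X t) := by
  have hX : X' t * conj (X t) + X t * conj (X' t) = 0 :=
    hasDerivAt_unique_of_eqOn hIo ht ((h.hasDerivAt_X t ht).fun_mul (h.hasDerivAt_X t ht).star)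
      (hasDerivAt_const t (1 : ℂ)) fun _ => h.mul_conj_X
  refine Complex.conj_eq_iff_re.1 ?_
  simp only [map_mul, map_neg, Complex.conj_I, Complex.conj_conj]
  linear_combination Complex.I * hX

theorem X'_eq (h : IsJacobiMotion I κ X X' y y') (hIo : IsOpen I) {t : ℝ} (ht : t ∈ I) :
    X' t = Complex.I * angularVelocity X X' t * X t := by
  rw [h.ofReal_angularVelocity hIo ht]
  linear_combination -X' t * h.mul_conj_X ht + X' t * X t * conj (X t) * Complex.I_sq

theorem norm_mul_conj_X (h : IsJacobiMotion I κ X X' y y') {t : ℝ} (ht : t ∈ I) (a : ℂ) :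
    ‖a * conj (X t)‖ = ‖a‖ := by
  rw [norm_mul, Complex.norm_conj, h.norm_X t ht, mul_one]

theorem mul_conj_X_add_one (h : IsJacobiMotion I κ X X' y y') {t : ℝ} (ht : t ∈ I) :
    y t * conj (X t) + 1 = (y t + X t) * conj (X t) := by
  rw [add_mul, h.mul_conj_X ht]

theorem mul_conj_X_sub_one (h : IsJacobiMotion I κ X X' y y') {t : ℝ} (ht : t ∈ I) :
    y t * conj (X t) - 1 = (y t - X t) * conj (X t) := by
  rw [sub_mul, h.mul_conj_X ht]

theorem hasDerivAt_conj_X (h : IsJacobiMotion I κ X X' y y') (hIo : IsOpen I) {t : ℝ}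
    (ht : t ∈ I) : HasDerivAt (fun t => conj (X t))
      (-(Complex.I * angularVelocity X X' t * conj (X t))) t :=
  (h.hasDerivAt_X t ht).star.congr_deriv (by simp [h.X'_eq hIo ht])

theorem hasDerivAt_angularVelocity (h : IsJacobiMotion I κ X X' y y') (hIo : IsOpen I) {t : ℝ}
    (ht : t ∈ I) : HasDerivAt (fun t => (angularVelocity X X' t : ℂ))
      (-Complex.I * (angularVelocity X X' t ^ 2 - κ * (1
        + 2 * ((‖y t * conj (X t) + 1‖ : ℂ)⁻¹ ^ 3 * (y t * conj (X t) + 1))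
        - 2 * ((‖y t * conj (X t) - 1‖ : ℂ)⁻¹ ^ 3 * (y t * conj (X t) - 1))))) t := by
  refine ((((h.hasDerivAt_X' t ht).const_mul (-Complex.I)).fun_mul
    (h.hasDerivAt_conj_X hIo ht)).congr_of_eventuallyEq
      (Filter.mem_of_superset (hIo.mem_nhds ht) fun t ht =>
        h.ofReal_angularVelocity hIo ht)).congr_deriv ?_
  rw [h.X'_eq hIo ht, h.mul_conj_X_add_one ht, h.mul_conj_X_sub_one ht, h.norm_mul_conj_X ht,
    h.norm_mul_conj_X ht]
  linear_combination (Complex.I * κ + Complex.I ^ 3 * angularVelocity X X' t ^ 2)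
    * h.mul_conj_X ht + Complex.I * angularVelocity X X' t ^ 2 * Complex.I_sq

theorem angularVelocity_sq (h : IsJacobiMotion I κ X X' y y') (hIo : IsOpen I) {t : ℝ}
    (ht : t ∈ I) : (angularVelocity X X' t : ℂ) ^ 2 = κ * (1 +
      ((‖y t * conj (X t) + 1‖ : ℂ)⁻¹ ^ 3 * (y t * conj (X t) + 1)
        + (‖y t * conj (X t) + 1‖ : ℂ)⁻¹ ^ 3 * (conj (y t * conj (X t)) + 1))
      - ((‖y t * conj (X t) - 1‖ : ℂ)⁻¹ ^ 3 * (y t * conj (X t) - 1)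
        + (‖y t * conj (X t) - 1‖ : ℂ)⁻¹ ^ 3 * (conj (y t * conj (X t)) - 1))) := by
  have hw := h.hasDerivAt_angularVelocity hIo ht
  have hreal := hw.unique (hw.star.congr_of_eventuallyEq (.of_forall fun t => by simp))
  generalize y t * conj (X t) = z at *
  simp only [RCLike.star_def, map_mul, map_add, map_sub, map_neg, map_pow, map_inv₀, map_one,
    map_ofNat, Complex.conj_I, Complex.conj_ofReal] at hreal
  refine mul_left_cancel₀ (mul_ne_zero two_ne_zero Complex.I_ne_zero) ?_
  linear_combination -hreal

theorem isRigidPairMotion (h : IsJacobiMotion I κ X X' y y') (hIo : IsOpen I) :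
    IsRigidPairMotion I κ (fun t => y t * conj (X t)) (fun t => y' t * conj (X t))
      (angularVelocity X X') where
  add_one_ne t ht := by
    rw [h.mul_conj_X_add_one ht, ← norm_ne_zero_iff, h.norm_mul_conj_X ht, norm_ne_zero_iff]
    exact h.add_ne t ht
  sub_one_ne t ht := by
    rw [h.mul_conj_X_sub_one ht, ← norm_ne_zero_iff, h.norm_mul_conj_X ht, norm_ne_zero_iff]
    exact h.sub_ne t ht
  hasDerivAt_z t ht := ((h.hasDerivAt_y t ht).fun_mul (h.hasDerivAt_conj_X hIo ht)).congr_deriv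
    (by ring)
  hasDerivAt_p t ht := by
    refine ((h.hasDerivAt_y' t ht).fun_mul (h.hasDerivAt_conj_X hIo ht)).congr_deriv ?_
    rw [h.mul_conj_X_add_one ht, h.mul_conj_X_sub_one ht, h.norm_mul_conj_X ht,
      h.norm_mul_conj_X ht]
    ring
  hasDerivAt_w t ht := (h.hasDerivAt_angularVelocity hIo ht).congr_deriv
    (by linear_combination -Complex.I * h.angularVelocity_sq hIo ht)
  rigidity _ ht := h.angularVelocity_sq hIo ht

end IsJacobiMotion

end Jacobi

section NBody

theorem exists_eq_add_smul_of_hasDerivAt {E : Type*} [NormedAddCommGroup E] [NormedSpace ℝ E]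
    {I : Set ℝ} {f g : ℝ → E} (hIo : IsOpen I) (hIc : IsPreconnected I)
    (hf : ∀ t ∈ I, HasDerivAt f (g t) t) (hg : ∀ t ∈ I, HasDerivAt g 0 t) :
    ∃ a b : E, ∀ t ∈ I, f t = a + t • b := by
  obtain ⟨b, hb⟩ := exists_eq_of_hasDerivAt_zero hIo hIc hg
  obtain ⟨a, ha⟩ := exists_eq_of_hasDerivAt_zero hIo hIc (f := fun t => f t - t • b) fun t ht =>
    ((hf t ht).sub ((hasDerivAt_id t).smul_const b)).congr_deriv
      (by rw [hb t ht, one_smul, sub_self])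
  exact ⟨a, b, fun t ht => sub_eq_iff_eq_add.1 (ha t ht)⟩

/-- The acceleration `∑_{j ≠ i} m_j (x_j - x_i) / |x_j - x_i|³` of the body `i` under the
attraction of the others. -/
noncomputable def nBodyAcceleration {ι E : Type*} [Fintype ι] [DecidableEq ι]
    [NormedAddCommGroup E] [InnerProductSpace ℝ E] (m : ι → ℝ) (x : ι → E) (i : ι) : E :=
  ∑ j ∈ Finset.univ.erase i, (m j / ‖x j - x i‖ ^ 3) • (x j - x i)

theorem sum_smul_nBodyAcceleration {ι E : Type*} [Fintype ι] [DecidableEq ι]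
    [NormedAddCommGroup E] [InnerProductSpace ℝ E] (m : ι → ℝ) (x : ι → E) :
    ∑ i, m i • nBodyAcceleration m x i = 0 := by
  have := IsAddTorsionFree.of_isTorsionFree ℝ E
  have hself (i : ι) :
      nBodyAcceleration m x i = ∑ j, (m j / ‖x j - x i‖ ^ 3) • (x j - x i) :=
    Finset.sum_erase _ (by simp)
  have hanti (i j : ι) : m j • (m i / ‖x i - x j‖ ^ 3) • (x i - x j)
      = -(m i • (m j / ‖x j - x i‖ ^ 3) • (x j - x i)) := by
    rw [norm_sub_rev (x j), smul_smul, smul_smul, ← smul_neg, neg_sub, mul_div_left_comm]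
  simp only [hself, Finset.smul_sum]
  refine self_eq_neg.1 (Finset.sum_comm.trans ?_)
  simp only [← Finset.sum_neg_distrib]
  exact Finset.sum_congr rfl fun i _ => Finset.sum_congr rfl fun j _ => hanti i j

namespace IsNBodySolution

variable {ι ι' E F : Type*} [Fintype ι] [DecidableEq ι] [Fintype ι'] [DecidableEq ι']
  [NormedAddCommGroup E] [InnerProductSpace ℝ E] [NormedAddCommGroup F] [InnerProductSpace ℝ F]
  {m : ι → ℝ} {I : Set ℝ} {q : ι → ℝ → E}

theorem map (h : IsNBodySolution m I q) (L : E →ₗᵢ[ℝ] F) :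
    IsNBodySolution m I fun i t => L (q i t) := by
  refine ⟨fun t ht i j hij => L.injective.ne (h.no_collision t ht i j hij), ?_⟩
  obtain ⟨v, hv⟩ := h.newton
  have hL {f : ℝ → E} {f' : E} {t : ℝ} (hf : HasDerivAt f f' t) :
      HasDerivAt (fun t => L (f t)) (L f') t :=
    L.toContinuousLinearMap.hasFDerivAt.comp_hasDerivAt t hf
  refine ⟨fun i t => L (v i t), fun t ht i => ⟨hL (hv t ht i).1, ?_⟩⟩
  refine (hL (hv t ht i).2).congr_deriv ?_
  simp only [map_sum, map_smul, ← map_sub, L.norm_map]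

theorem comp_equiv (h : IsNBodySolution m I q) (σ : ι' ≃ ι) :
    IsNBodySolution (fun i => m (σ i)) I fun i => q (σ i) := by
  refine ⟨fun t ht i j hij => h.no_collision t ht _ _ (σ.injective.ne hij), ?_⟩
  obtain ⟨v, hv⟩ := h.newton
  refine ⟨fun i => v (σ i), fun t ht i => ⟨(hv t ht _).1, (hv t ht _).2.congr_deriv ?_⟩⟩
  exact (Finset.sum_equiv σ (by simp) fun _ _ => rfl).symm

theorem exists_sum_smul_eq (h : IsNBodySolution m I q) (hIo : IsOpen I)
    (hIc : IsPreconnected I) : ∃ a b : E, ∀ t ∈ I, ∑ i, m i • q i t = a + t • b := by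
  obtain ⟨v, hv⟩ := h.newton
  refine exists_eq_add_smul_of_hasDerivAt hIo hIc (g := fun t => ∑ i, m i • v i t)
    (fun t ht => .fun_sum fun i _ => (hv t ht i).1.const_smul (m i)) fun t ht => ?_
  rw [← sum_smul_nBodyAcceleration m fun i => q i t]
  exact .fun_sum fun i _ => (hv t ht i).2.const_smul (m i)

end IsNBodySolution

end NBody

section ThreeBodies

theorem attraction_mul {d : ℝ} (hd : 0 < d) (m : ℝ) (a : ℂ) :
    (m / ‖d * a‖ ^ 3) • (d * a) = m / d ^ 2 * ((‖a‖ : ℂ)⁻¹ ^ 3 * a) := by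
  have hd' : (d : ℂ) ≠ 0 := Complex.ofReal_ne_zero.2 hd.ne'
  rw [norm_mul, Complex.norm_of_nonneg hd.le, Complex.real_smul]
  push_cast
  field_simp

section JacobiCoordinates

variable {m d : ℝ} {x : Fin 3 → ℂ} {X y : ℂ}

theorem nBodyAcceleration_zero (hd : 0 < d) (hX : ‖X‖ = 1) (h01 : x 1 - x 0 = d * (2 * X))
    (h02 : x 2 - x 0 = d * (y + X)) : nBodyAcceleration (fun _ => m) x 0
      = m / d ^ 2 * (X / 4 + (‖y + X‖ : ℂ)⁻¹ ^ 3 * (y + X)) := by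
  rw [nBodyAcceleration, show Finset.univ.erase (0 : Fin 3) = {1, 2} by decide,
    Finset.sum_pair (by decide), h01, h02, attraction_mul hd, attraction_mul hd, norm_mul, hX,
    Complex.norm_two]
  push_cast
  ring

theorem nBodyAcceleration_one (hd : 0 < d) (hX : ‖X‖ = 1) (h01 : x 1 - x 0 = d * (2 * X))
    (h12 : x 2 - x 1 = d * (y - X)) : nBodyAcceleration (fun _ => m) x 1
      = m / d ^ 2 * (-(X / 4) + (‖y - X‖ : ℂ)⁻¹ ^ 3 * (y - X)) := by
  rw [nBodyAcceleration, show Finset.univ.erase (1 : Fin 3) = {0, 2} by decide,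
    Finset.sum_pair (by decide), ← neg_sub (x 1), h01, h12, ← mul_neg, attraction_mul hd,
    attraction_mul hd, norm_neg, norm_mul, hX, Complex.norm_two]
  push_cast
  ring

theorem nBodyAcceleration_two (hd : 0 < d) (h02 : x 2 - x 0 = d * (y + X))
    (h12 : x 2 - x 1 = d * (y - X)) : nBodyAcceleration (fun _ => m) x 2
      = -(m / d ^ 2 * ((‖y + X‖ : ℂ)⁻¹ ^ 3 * (y + X) + (‖y - X‖ : ℂ)⁻¹ ^ 3 * (y - X))) := by
  rw [nBodyAcceleration, show Finset.univ.erase (2 : Fin 3) = {0, 1} by decide,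
    Finset.sum_pair (by decide), ← neg_sub (x 2) (x 0), ← neg_sub (x 2) (x 1), h02, h12, ← mul_neg,
    ← mul_neg, attraction_mul hd, attraction_mul hd, norm_neg, norm_neg]
  ring

end JacobiCoordinates

namespace IsNBodySolution

variable {m d : ℝ} {I : Set ℝ} {f : Fin 3 → ℝ → ℂ}

theorem exists_isJacobiMotion (h : IsNBodySolution (fun _ => m) I f) (hd : 0 < d)
    (hdist : ∀ t ∈ I, ‖f 1 t - f 0 t‖ = 2 * d) :
    ∃ X' y' : ℝ → ℂ, IsJacobiMotion I (m / (4 * d ^ 3)) (fun t => (f 1 t - f 0 t) / (2 * d)) X'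
      (fun t => (f 2 t - (f 0 t + f 1 t) / 2) / d) y' := by
  have hd' : (d : ℂ) ≠ 0 := Complex.ofReal_ne_zero.2 hd.ne'
  obtain ⟨v, hv⟩ := h.newton
  set X : ℝ → ℂ := fun t => (f 1 t - f 0 t) / (2 * d) with hX
  set y : ℝ → ℂ := fun t => (f 2 t - (f 0 t + f 1 t) / 2) / d with hy
  have h01 (t : ℝ) : f 1 t - f 0 t = d * (2 * X t) := by simp only [hX]; field_simp
  have h02 (t : ℝ) : f 2 t - f 0 t = d * (y t + X t) := by simp only [hX, hy]; field_simp; ring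
  have h12 (t : ℝ) : f 2 t - f 1 t = d * (y t - X t) := by simp only [hX, hy]; field_simp; ring
  have hnorm : ∀ t ∈ I, ‖X t‖ = 1 := fun t ht => by
    have := hdist t ht
    rw [h01, norm_mul, norm_mul, Complex.norm_of_nonneg hd.le, Complex.norm_two] at this
    exact mul_left_cancel₀ (mul_ne_zero two_ne_zero hd.ne') (by linarith)
  have hv₀ (t) (ht : t ∈ I) :=
    (hv t ht 0).2.congr_deriv (nBodyAcceleration_zero hd (hnorm t ht) (h01 t) (h02 t))
  have hv₁ (t) (ht : t ∈ I) :=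
    (hv t ht 1).2.congr_deriv (nBodyAcceleration_one hd (hnorm t ht) (h01 t) (h12 t))
  have hv₂ (t) (ht : t ∈ I) :=
    (hv t ht 2).2.congr_deriv (nBodyAcceleration_two hd (h02 t) (h12 t))
  refine ⟨fun t => (v 1 t - v 0 t) / (2 * d), fun t => (v 2 t - (v 0 t + v 1 t) / 2) / d, hnorm,
    fun t ht => right_ne_zero_of_mul (h02 t ▸ sub_ne_zero.2 (h.no_collision t ht _ _ (by decide))),
    fun t ht => right_ne_zero_of_mul (h12 t ▸ sub_ne_zero.2 (h.no_collision t ht _ _ (by decide))),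
    fun t ht => ((hv t ht 1).1.sub (hv t ht 0).1).div_const _,
    fun t ht => ((hv t ht 2).1.sub (((hv t ht 0).1.add (hv t ht 1).1).div_const _)).div_const _,
    fun t ht => (((hv₁ t ht).sub (hv₀ t ht)).div_const _).congr_deriv ?_,
    fun t ht => (((hv₂ t ht).sub (((hv₀ t ht).add (hv₁ t ht)).div_const _)).div_const _).congr_deriv
      ?_⟩
  · push_cast; field_simp; ring
  · push_cast; field_simp; ring

end IsNBodySolution

end ThreeBodies

section UniformRotation

theorem exists_eq_exp_mul {I : Set ℝ} {X : ℝ → ℂ} {ω : ℝ} (hIo : IsOpen I)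
    (hIc : IsPreconnected I) (hX : ∀ t ∈ I, HasDerivAt X (Complex.I * ω * X t) t) :
    ∃ X₀ : ℂ, ∀ t ∈ I, X t = Complex.exp ((ω * t : ℝ) * Complex.I) * X₀ := by
  have hexp (t : ℝ) : HasDerivAt (fun t : ℝ => Complex.exp (-((ω * t : ℝ) * Complex.I)))
      (Complex.exp (-((ω * t : ℝ) * Complex.I)) * -(ω * Complex.I)) t :=
    (((hasDerivAt_id t).const_mul ω).ofReal_comp.mul_const Complex.I).neg.cexp.congr_deriv (by simp)
  obtain ⟨X₀, hX₀⟩ := exists_eq_of_hasDerivAt_zero hIo hIc fun t ht =>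
    ((hX t ht).fun_mul (hexp t)).congr_deriv (by ring)
  refine ⟨X₀, fun t ht => ?_⟩
  rw [← hX₀ t ht, mul_left_comm, ← Complex.exp_add, add_neg_cancel, Complex.exp_zero, mul_one]

theorem IsJacobiMotion.exists_uniform_rotation {I : Set ℝ} {κ : ℝ} {X X' y y' : ℝ → ℂ}
    (h : IsJacobiMotion I κ X X' y y') (hκ : κ ≠ 0) (hIo : IsOpen I) (hIc : IsPreconnected I)
    (hne : I.Nonempty) :
    ∃ (X₀ c : ℂ) (ω : ℝ), X₀ ≠ 0 ∧
      (IsEulerPoint c ∨ IsLagrangePoint c) ∧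
      ∀ t ∈ I, X t = Complex.exp ((ω * t : ℝ) * Complex.I) * X₀ ∧ y t = X t * c := by
  obtain ⟨c, ω, hrest, hc⟩ := (h.isRigidPairMotion hIo).exists_rest hκ hIo hIc hne
  obtain ⟨X₀, hX₀⟩ := exists_eq_exp_mul hIo hIc fun t ht =>
    (h.hasDerivAt_X t ht).congr_deriv (by rw [h.X'_eq hIo ht, (hrest t ht).2])
  obtain ⟨t₀, ht₀⟩ := hne
  refine ⟨X₀, c, ω, ?_, hc, fun t ht => ⟨hX₀ t ht, ?_⟩⟩
  · have hX := h.norm_X t₀ ht₀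
    rw [hX₀ t₀ ht₀] at hX
    exact right_ne_zero_of_mul (norm_ne_zero_iff.1 (hX ▸ one_ne_zero))
  · linear_combination X t * (hrest t ht).1 - y t * h.mul_conj_X ht

/-- The positions, relative to their centre of mass, of three equal masses of which the first two
are at `-1` and `1` and the third is at `c`. -/
noncomputable def centeredShape (c : ℂ) : Fin 3 → ℂ :=
  ![-1 - c / 3, 1 - c / 3, 2 * c / 3]

theorem centeredShape_zero (c : ℂ) : centeredShape c 0 = -1 - c / 3 := rfl

theorem centeredShape_one (c : ℂ) : centeredShape c 1 = 1 - c / 3 := rfl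

theorem centeredShape_two (c : ℂ) : centeredShape c 2 = 2 * c / 3 := rfl

theorem sum_centeredShape (c : ℂ) : ∑ i, centeredShape c i = 0 := by
  rw [Fin.sum_univ_three, centeredShape_zero, centeredShape_one, centeredShape_two]
  ring

theorem eq_add_centeredShape {x : Fin 3 → ℂ} {s u c : ℂ} (hs : ∑ i, x i = 3 * s)
    (h01 : x 1 - x 0 = 2 * u) (h2 : x 2 - (x 0 + x 1) / 2 = u * c) (i : Fin 3) :
    x i = s + u * centeredShape c i := by
  rw [Fin.sum_univ_three] at hs
  match i with
  | 0 => rw [centeredShape_zero]; linear_combination hs / 3 - h01 / 2 - h2 / 3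
  | 1 => rw [centeredShape_one]; linear_combination hs / 3 + h01 / 2 - h2 / 3
  | 2 => rw [centeredShape_two]; linear_combination hs / 3 + 2 / 3 * h2

theorem IsNBodySolution.exists_uniform_rotation {m : ℝ} {I : Set ℝ} {f : Fin 3 → ℝ → ℂ}
    (h : IsNBodySolution (fun _ => m) I f) (hm : m ≠ 0) (hIo : IsOpen I) (hIc : IsPreconnected I)
    (hne : I.Nonempty) (hdist : HasConstantDistance I f 0 1) :
    ∃ (a b u c : ℂ) (ω : ℝ), u ≠ 0 ∧
      (IsEulerPoint c ∨ IsLagrangePoint c) ∧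
      ∀ t ∈ I, ∀ i, f i t =
        a + t • b + Complex.exp ((ω * t : ℝ) * Complex.I) * (u * centeredShape c i) := by
  obtain ⟨r, hr⟩ := hdist
  have ⟨t₀, ht₀⟩ := hne
  have hr₀ : 0 < r := hr t₀ ht₀ ▸ dist_pos.2 (h.no_collision t₀ ht₀ 0 1 (by decide))
  have hd : 0 < r / 2 := half_pos hr₀
  have hd' : ((r / 2 : ℝ) : ℂ) ≠ 0 := Complex.ofReal_ne_zero.2 hd.ne'
  obtain ⟨X', y', hJ⟩ := h.exists_isJacobiMotion hd fun t ht => by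
    rw [← dist_eq_norm', hr t ht, mul_div_cancel₀ r two_ne_zero]
  obtain ⟨X₀, c, ω, hX₀, hc, hXy⟩ :=
    hJ.exists_uniform_rotation (div_ne_zero hm (by positivity)) hIo hIc hne
  obtain ⟨a, b, hab⟩ := h.exists_sum_smul_eq hIo hIc
  refine ⟨a / (3 * m), b / (3 * m), (r / 2 : ℝ) * X₀, c, ω, mul_ne_zero hd' hX₀, hc,
    fun t ht i => ?_⟩
  obtain ⟨hX, hy⟩ := hXy t ht
  have hsum := hab t ht
  rw [hX, div_eq_iff hd'] at hy
  rw [div_eq_iff (mul_ne_zero two_ne_zero hd')] at hX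
  rw [← Finset.smul_sum, Complex.real_smul, Complex.real_smul] at hsum
  rw [← mul_assoc]
  refine eq_add_centeredShape (x := fun i => f i t) ?_ ?_ ?_ i
  · have hm' : (m : ℂ) ≠ 0 := Complex.ofReal_ne_zero.2 hm
    rw [Complex.real_smul]
    field_simp
    linear_combination hsum
  · linear_combination hX
  · linear_combination hy

end UniformRotation

section Plane

/-- The identification of the complex plane with the Euclidean plane. -/
noncomputable def complexToPlane : ℂ ≃ₗᵢ[ℝ] EuclideanSpace ℝ (Fin 2) :=
  Complex.orthonormalBasisOneI.repr

theorem planeRotation_complexToPlane (θ : ℝ) (z : ℂ) :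
    planeRotation θ (complexToPlane z) =
      complexToPlane (Complex.exp (θ * Complex.I) * z) := by
  ext i
  fin_cases i <;>
    simp [planeRotation, complexToPlane, Complex.exp_ofReal_mul_I_re, Complex.exp_ofReal_mul_I_im,
      add_comm]

theorem dist_planeRotation (θ : ℝ) (p p' : EuclideanSpace ℝ (Fin 2)) :
    dist (planeRotation θ p) (planeRotation θ p') = dist p p' := by
  obtain ⟨z, rfl⟩ := complexToPlane.surjective p
  obtain ⟨z', rfl⟩ := complexToPlane.surjective p'
  rw [planeRotation_complexToPlane, planeRotation_complexToPlane, LinearIsometryEquiv.dist_map,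
    LinearIsometryEquiv.dist_map, dist_eq_norm, dist_eq_norm, ← mul_sub, norm_mul,
    Complex.norm_exp_ofReal_mul_I, one_mul]

theorem isEquilateral_centeredShape {u c : ℂ} (hu : u ≠ 0) (hc : IsLagrangePoint c) :
    IsEquilateral fun i => complexToPlane (u * centeredShape c i) := by
  obtain ⟨h₁, h₂⟩ := hc
  refine ⟨‖u‖ * 2, by positivity, fun i j hij => ?_⟩
  wlog hlt : i < j generalizing i j
  · rw [dist_comm, this j i hij.symm (lt_of_le_of_ne (not_lt.1 hlt) hij.symm)]
  have h01 : centeredShape c 0 - centeredShape c 1 = -2 := by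
    rw [centeredShape_zero, centeredShape_one]; ring
  have h02 : centeredShape c 0 - centeredShape c 2 = -(c + 1) := by
    rw [centeredShape_zero, centeredShape_two]; ring
  have h12 : centeredShape c 1 - centeredShape c 2 = -(c - 1) := by
    rw [centeredShape_one, centeredShape_two]; ring
  rw [LinearIsometryEquiv.dist_map, dist_eq_norm, ← mul_sub, norm_mul]
  congr 1
  fin_cases i <;> fin_cases j <;> simp_all [-neg_add_rev, -neg_sub]

theorem isSymmetricCollinear_of_add_eq {p : Fin 3 → ℂ} {u : ℂ} (hu : u ≠ 0) {i j k : Fin 3}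
    (hij : i ≠ j) (hik : i ≠ k) (hjk : p j ≠ p k) (h : p j + p k = 2 * p i) :
    IsSymmetricCollinear fun l => complexToPlane (u * p l) := by
  refine ⟨i, j, k, hij, hik, complexToPlane.injective.ne ((mul_right_injective₀ hu).ne hjk), ?_⟩
  have hmid : u * p i = midpoint ℝ (u * p j) (u * p k) := by
    rw [midpoint_eq_smul_add, ← mul_add, h, mul_left_comm, Complex.real_smul]
    simp
  simp only [hmid, midpoint_eq_smul_add, map_smul, map_add]

theorem isSymmetricCollinear_centeredShape {u c : ℂ} (hu : u ≠ 0) (hc : IsEulerPoint c) :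
    IsSymmetricCollinear fun i => complexToPlane (u * centeredShape c i) := by
  rcases hc with rfl | rfl | rfl
  · refine isSymmetricCollinear_of_add_eq hu (i := 2) (j := 0) (k := 1)
      (by decide) (by decide) ?_ ?_
    all_goals norm_num [centeredShape_zero, centeredShape_one, centeredShape_two]
  · refine isSymmetricCollinear_of_add_eq hu (i := 1) (j := 0) (k := 2)
      (by decide) (by decide) ?_ ?_
    all_goals norm_num [centeredShape_zero, centeredShape_one, centeredShape_two]
  · refine isSymmetricCollinear_of_add_eq hu (i := 0) (j := 1) (k := 2)
      (by decide) (by decide) ?_ ?_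
    all_goals norm_num [centeredShape_zero, centeredShape_one, centeredShape_two]

theorem IsEquilateral.comp_perm {p : Fin 3 → EuclideanSpace ℝ (Fin 2)} (h : IsEquilateral p)
    (σ : Equiv.Perm (Fin 3)) : IsEquilateral fun i => p (σ i) := by
  obtain ⟨s, hs, hdist⟩ := h
  exact ⟨s, hs, fun i j hij => hdist _ _ (σ.injective.ne hij)⟩

theorem IsSymmetricCollinear.comp_perm {p : Fin 3 → EuclideanSpace ℝ (Fin 2)}
    (h : IsSymmetricCollinear p) (σ : Equiv.Perm (Fin 3)) :
    IsSymmetricCollinear fun i => p (σ i) := by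
  obtain ⟨i, j, k, hij, hik, hjk, hmid⟩ := h
  refine ⟨σ.symm i, σ.symm j, σ.symm k, σ.symm.injective.ne hij, σ.symm.injective.ne hik, ?_⟩
  simpa only [σ.apply_symm_apply] using ⟨hjk, hmid⟩

end Plane

section Lagrange

variable {I : Set ℝ} {q : Fin 3 → ℝ → EuclideanSpace ℝ (Fin 2)}

theorem IsLagrangeMotion.isRelativeEquilibrium (h : IsLagrangeMotion I q) :
    IsRelativeEquilibrium I q := by
  obtain ⟨a, b, ω, p, -, -, hq⟩ := h
  intro i j _
  refine ⟨dist (p i) (p j), fun t ht => ?_⟩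
  rw [hq t ht, hq t ht, dist_add_left, dist_planeRotation]

theorem IsLagrangeMotion.comp_perm (h : IsLagrangeMotion I q) (σ : Equiv.Perm (Fin 3)) :
    IsLagrangeMotion I fun i => q (σ i) := by
  obtain ⟨a, b, ω, p, hsum, hshape, hq⟩ := h
  exact ⟨a, b, ω, fun i => p (σ i), (Equiv.sum_comp σ p).trans hsum,
    hshape.imp (·.comp_perm σ) (·.comp_perm σ), fun t ht i => hq t ht (σ i)⟩

theorem isLagrangeMotion_of_eq_exp_mul {a b u c : ℂ} {ω : ℝ} (hu : u ≠ 0)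
    (hc : IsEulerPoint c ∨ IsLagrangePoint c)
    (h : ∀ t ∈ I, ∀ i, complexToPlane.symm (q i t) =
      a + t • b + Complex.exp ((ω * t : ℝ) * Complex.I) * (u * centeredShape c i)) :
    IsLagrangeMotion I q := by
  refine ⟨complexToPlane a, complexToPlane b, ω, fun i => complexToPlane (u * centeredShape c i),
    ?_, ?_, fun t ht i => ?_⟩
  · rw [← map_sum, ← Finset.mul_sum, sum_centeredShape, mul_zero, map_zero]
  · exact hc.symm.imp (isEquilateral_centeredShape hu)
      (isSymmetricCollinear_centeredShape hu)
  · rw [planeRotation_complexToPlane, ← map_smul, ← map_add, ← map_add, ← h t ht i,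
      LinearIsometryEquiv.apply_symm_apply]

theorem isLagrangeMotion_empty : IsLagrangeMotion ∅ q :=
  isLagrangeMotion_of_eq_exp_mul (a := 0) (b := 0) (u := 1) (c := 0) (ω := 0) one_ne_zero
    (.inl (.inl rfl)) fun _ ht => ht.elim

theorem IsNBodySolution.isLagrangeMotion {m : ℝ} (h : IsNBodySolution (fun _ => m) I q)
    (hm : m ≠ 0) (hIo : IsOpen I) (hIc : IsPreconnected I) {i j : Fin 3} (hij : i ≠ j)
    (hdist : HasConstantDistance I q i j) : IsLagrangeMotion I q := by
  rcases I.eq_empty_or_nonempty with rfl | hne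
  · exact isLagrangeMotion_empty
  obtain ⟨σ, rfl, rfl⟩ : ∃ σ : Equiv.Perm (Fin 3), σ 0 = i ∧ σ 1 = j := by
    clear hdist
    decide +revert
  have hf := (h.comp_equiv σ).map complexToPlane.symm.toLinearIsometry
  obtain ⟨a, b, u, c, ω, hu, hc, hmotion⟩ := hf.exists_uniform_rotation hm hIo hIc hne
    (hdist.imp fun r hr t ht => (LinearIsometryEquiv.dist_map _ _ _).trans (hr t ht))
  simpa using (isLagrangeMotion_of_eq_exp_mul hu hc hmotion).comp_perm σ.symm

end Lagrange

theorem theorem1_general (m : ℝ) (hm : m ≠ 0) (I : Set ℝ) (hIo : IsOpen I) (hIc : I.OrdConnected)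
    (q : Fin 3 → ℝ → EuclideanSpace ℝ (Fin 2)) (hq : IsNBodySolution (fun _ => m) I q) :
    ¬ IsPartiallyRigid I q ∧
    ((∃ i j, i ≠ j ∧ HasConstantDistance I q i j) →
      IsRelativeEquilibrium I q ∧ IsLagrangeMotion I q) := by
  have hrigid : (∃ i j, i ≠ j ∧ HasConstantDistance I q i j) →
      IsRelativeEquilibrium I q ∧ IsLagrangeMotion I q := fun ⟨_, _, hij, hdist⟩ =>
    have hL := hq.isLagrangeMotion hm hIo hIc.isPreconnected hij hdist
    ⟨hL.isRelativeEquilibrium, hL⟩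
  exact ⟨fun h => h.2 (hrigid h.1).1, hrigid⟩

theorem theorem1 (m : ℝ) (hm : 0 < m) (I : Set ℝ) (hIo : IsOpen I) (hIc : I.OrdConnected)
    (q : Fin 3 → ℝ → EuclideanSpace ℝ (Fin 2)) (hq : IsNBodySolution (fun _ => m) I q) :
    ¬ IsPartiallyRigid I q ∧
    ((∃ i j, i ≠ j ∧ HasConstantDistance I q i j) →
      IsRelativeEquilibrium I q ∧ IsLagrangeMotion I q) :=
  theorem1_general m hm.ne' I hIo hIc q hq
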